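/- Let $m>2$ be an integer and let $0<2\alpha<1$. For $x,\xi\in\mathbb R^m$ put $r^2=\sum_{i=1}^m(x_i-\xi_i)^2$, $r_1^2=(x_1+\xi_1)^2+\sum_{i=2}^m(x_i-\xi_i)^2$, and $$q_1(x,\xi)=k_1\,(r^2)^{-\alpha-\frac{m-2}{2}}\,F\Big(\alpha+\tfrac{m-2}{2},\alpha;2\alpha;1-\tfrac{r_1^2}{r^2}\Big),\qquad k_1=\frac{\Gamma(\alpha)\,\Gamma(\alpha+\frac{m-2}{2})}{4^{1-\alpha}\,\pi^{m/2}\,\Gamma(2\alpha)},$$ where $F$ is the Gauss hypergeometric function, continued analytically to $(-\infty,1)$. Let $\Omega\subset\{x_1>0\}$ be a bounded domain in $\mathbb R^m$ whose boundary is $\Gamma_1\cup\gamma\cup\Gamma$, where $\Gamma_1$ is a relatively open part of the hyperplane $\{x_1=0\}$, $\gamma=\overline{\Gamma_1}\setminus\Gamma_1$ is the boundary of $\Gamma_1$ in this hyperplane, and $\Gamma\subset\{x_1>0\}$ is a Lyapunov surface with $\overline\Gamma=\Gamma\cup\gamma$ that approaches the hyperplane at a right angle. That is: $\Gamma$ together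 with its boundary $\gamma$ is a $C^1$ hypersurface with $\Omega$ locally on one side, so that near each point $p\in\Gamma\cup\gamma$ there is a $C^1$ function $\varphi$ with non-vanishing gradient for which $\Gamma\cup\gamma=\{x_1\ge 0,\ \varphi=0\}$ and $\Omega=\{x_1>0,\ \varphi<0\}$, and $n=\nabla\varphi/|\nabla\varphi|$ is the outer unit normal; there are constants $a,\lambda>0$ such that for all $x,\xi\in\Gamma$ the angle between $n(x)$ and $n(\xi)$ is at most $a|x-\xi|^\lambda$; and $n_1=0$ on $\gamma$. Then for every point $(0,x')$, $x'=(x_2,\dots,x_m)\in\mathbb R^{m-1}$, the double-layer potential with unit density $$w_1^{(1)}(0,x')=\int_\Gamma \xi_1^{2\alpha}\,\frac{\partial q_1(\xi,(0,x'))}{\partial n_\xi}\,d_\xi\Gamma$$ converges absolutely, and $$w_1^{(1)}(0,x')=\begin{cases}-1,&(0,x')\in\Gamma_1,\\ -\tfrac12,&(0,x')\in\gamma,\\ 0,&(0,x')\notin\Gamma_1\cup\gamma.\end{cases}$$ -/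

import Mathlib

open MeasureTheory

noncomputable section

/-- The real Gauss hypergeometric function `F(a, b; c; z)` on `z < 1`: the Gauss series for
`|z| < 1`, and its analytic continuation
`(1 - z)^(-b) F(c - a, b; c; z / (z - 1))` for `z ≤ -1`. -/
def gaussF (a b c z : ℝ) : ℝ :=
  if |z| < 1 then ordinaryHypergeometric a b c z
  else (1 - z) ^ (-b) * ordinaryHypergeometric (c - a) b c (z / (z - 1))

/-- `r² = ∑ᵢ (xᵢ - ξᵢ)²`. -/
def rSq {m : ℕ} (x ξ : EuclideanSpace ℝ (Fin m)) : ℝ :=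
  ∑ i, (x i - ξ i) ^ 2

/-- `r₁² = (x₁ + ξ₁)² + ∑_{i ≥ 2} (xᵢ - ξᵢ)²`; the first coordinate has index `0`. -/
def rOneSq {m : ℕ} [NeZero m] (x ξ : EuclideanSpace ℝ (Fin m)) : ℝ :=
  (x 0 + ξ 0) ^ 2 + ∑ i ∈ Finset.univ.erase (0 : Fin m), (x i - ξ i) ^ 2

/-- The constant `k₁ = Γ(α) Γ(α + (m-2)/2) / (4^(1-α) π^(m/2) Γ(2α))`. -/
def kOne (m : ℕ) (α : ℝ) : ℝ :=
  Real.Gamma α * Real.Gamma (α + ((m : ℝ) - 2) / 2) /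
    ((4 : ℝ) ^ (1 - α) * Real.pi ^ ((m : ℝ) / 2) * Real.Gamma (2 * α))

/-- The fundamental solution
`q₁(x, ξ) = k₁ (r²)^(-α-(m-2)/2) F(α + (m-2)/2, α; 2α; 1 - r₁²/r²)` of
`∑ᵢ u_{xᵢxᵢ} + (2α/x₁) u_{x₁} = 0`. -/
def qOne {m : ℕ} [NeZero m] (α : ℝ) (x ξ : EuclideanSpace ℝ (Fin m)) : ℝ :=
  kOne m α * rSq x ξ ^ (-α - ((m : ℝ) - 2) / 2) *
    gaussF (α + ((m : ℝ) - 2) / 2) α (2 * α) (1 - rOneSq x ξ / rSq x ξ)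

/-- The integrand `ξ₁^(2α) μ(ξ) ∂q₁(ξ, x)/∂n_ξ` of the double-layer potential. -/
def doubleLayerIntegrand {m : ℕ} [NeZero m] (α : ℝ)
    (n : EuclideanSpace ℝ (Fin m) → EuclideanSpace ℝ (Fin m))
    (μ : EuclideanSpace ℝ (Fin m) → ℝ) (x ξ : EuclideanSpace ℝ (Fin m)) : ℝ :=
  (ξ 0) ^ (2 * α) * μ ξ * fderiv ℝ (fun η => qOne α η x) ξ (n ξ)

/-- The double-layer potential over the surface `Γ` with unit normal field `n` and density `μ`;
the surface element is the `(m-1)`-dimensional Hausdorff measure, normalized to agree with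
Lebesgue measure on hyperplanes. -/
def doubleLayer {m : ℕ} [NeZero m] (α : ℝ) (Γ : Set (EuclideanSpace ℝ (Fin m)))
    (n : EuclideanSpace ℝ (Fin m) → EuclideanSpace ℝ (Fin m))
    (μ : EuclideanSpace ℝ (Fin m) → ℝ) (x : EuclideanSpace ℝ (Fin m)) : ℝ :=
  ∫ ξ in Γ, doubleLayerIntegrand α n μ x ξ ∂(μHE[m - 1])

/-- The boundary `γ` of a relatively open subset `Γ₁` of the (closed) hyperplane `x₁ = 0`. -/
def edge {m : ℕ} (Γ₁ : Set (EuclideanSpace ℝ (Fin m))) : Set (EuclideanSpace ℝ (Fin m)) :=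
  closure Γ₁ \ Γ₁

/-- `Ω` is a bounded domain of the half-space `x₁ > 0`, bounded by the relatively open part `Γ₁` of
the hyperplane `x₁ = 0` and by the Lyapunov surface `Γ`, with outer unit normal field `n`, that
meets the hyperplane at a right angle along the boundary of `Γ₁`. -/
structure IsLyapunovDomain {m : ℕ} [NeZero m] (Ω Γ₁ Γ : Set (EuclideanSpace ℝ (Fin m)))
    (n : EuclideanSpace ℝ (Fin m) → EuclideanSpace ℝ (Fin m)) : Prop where
  isOpen : IsOpen Ω
  isConnected : IsConnected Ω
  isBounded : Bornology.IsBounded Ω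
  pos_of_mem : ∀ x ∈ Ω, 0 < x 0
  /-- `Γ₁` is a relatively open part of the hyperplane. -/
  flat_open : ∃ V, IsOpen V ∧ Γ₁ = V ∩ {x | x 0 = 0}
  /-- `Γ` lies in the open half-space. -/
  pos_of_mem_surface : ∀ x ∈ Γ, 0 < x 0
  /-- The boundary of `Ω` consists of `Γ₁`, its boundary and `Γ`. -/
  frontier_eq : frontier Ω = Γ₁ ∪ edge Γ₁ ∪ Γ
  /-- `Γ` reaches the hyperplane exactly along the boundary of `Γ₁`. -/
  closure_surface : closure Γ = Γ ∪ edge Γ₁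
  /-- `Γ`, up to and including its boundary, has a definite normal at every point: near each of its
  points it is the zero set, in `x₁ ≥ 0`, of a `C¹` function `φ` with non-vanishing gradient, `Ω` is
  the part of `x₁ > 0` where `φ < 0`, and `n` is the normalized gradient. -/
  normal : ∀ p ∈ Γ ∪ edge Γ₁, ∃ (U : Set (EuclideanSpace ℝ (Fin m)))
    (φ : EuclideanSpace ℝ (Fin m) → ℝ),
      IsOpen U ∧ p ∈ U ∧ ContDiffOn ℝ 1 φ U ∧ (∀ x ∈ U, gradient φ x ≠ 0) ∧
      (Γ ∪ edge Γ₁) ∩ U = {x | x ∈ U ∧ 0 ≤ x 0 ∧ φ x = 0} ∧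
      Ω ∩ U = {x | x ∈ U ∧ 0 < x 0 ∧ φ x < 0} ∧
      ∀ x ∈ (Γ ∪ edge Γ₁) ∩ U, n x = ‖gradient φ x‖⁻¹ • gradient φ x
  /-- The angle between the normals at two points of `Γ` is Hölder in their distance. -/
  angle_le : ∃ a lam : ℝ, 0 < a ∧ 0 < lam ∧ ∀ x ∈ Γ, ∀ ξ ∈ Γ,
    InnerProductGeometry.angle (n x) (n ξ) ≤ a * dist x ξ ^ lam
  /-- `Γ` approaches the hyperplane `x₁ = 0` at a right angle. -/
  right_angle : ∀ p ∈ edge Γ₁, n p 0 = 0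

end

/-! For a pole `x` on the hyperplane `x₁ = 0` the two distances `r` and `r₁` coincide, the
hypergeometric factor is `F(0) = 1`, and `q₁(ξ, x) = k₁ |ξ - x|^(2 - m - 2α)`. The integrand is
therefore `-k₁ (2α + m - 2)` times the flux density of the field `ξ₁^(2α) |ξ - x|^(-2α-m) (ξ - x)`.
Its scalar weight is homogeneous of degree `-m` about `x`, so by Euler's identity the field is
divergence free where `ξ₁ > 0`.

Multiply the field by a cutoff `ζ(ξ₁/ε)` that vanishes near the hyperplane. The flat part of the
boundary and the pole then play no role, and the divergence theorem turns the flux through `Γ` into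
a volume integral. After `ξ = x + εz` this is the integral over `(Ω - x)/ε` of a fixed kernel `K(z)
= ζ'(z₁) z₁^(1+2α) |z|^(-2α-m)` (`setIntegral_cutoff_mul_fluxDensity`). As `ε → 0` the left side
tends to the full flux, and the right side to the integral of `K` over the tangent cone of `Ω` at
`x`. Within `z₁ > 0` the cone is everything for `x ∈ Γ₁`, the part `⟪n x, z⟫ < 0` for `x ∈ γ`, and
empty otherwise. Since `n₁ = 0` on `γ`, the reflection of the variables `z₂, …, z_m` shows that the
second cone carries half the mass. Slicing at `z₁ = t` gives the total mass as a quotient of Gamma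
functions, and `k₁` is its normalization (`kOne_mul_eq_one`).

Two analytic facts support this. Absolute convergence is an issue only at `x ∈ γ`; there the Hölder
condition gives `|⟪ξ - x, n ξ⟫| ≤ C |ξ - x|^(1+λ)` (`exists_abs_inner_le`), and the singularity
becomes integrable on an `(m-1)`-dimensional surface. The divergence theorem for a `C¹` surface with
Hausdorff measure is obtained locally from the fundamental theorem of calculus along lines
transversal to the surface. The projection along these lines is nearly isometric on a small piece,
so the formula holds there up to a small multiple of `∫ |f|`. A partition of unity adds these errors
without loss, and they can be made arbitrarily small. -/

open Set Filter Topology Submodule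
open scoped NNReal ENNReal RealInnerProductSpace

/-! ### Projection along a direction transversal to a hyperplane -/

section ObliqueProjection

variable {E : Type*} [NormedAddCommGroup E] [InnerProductSpace ℝ E]

/-- The projection onto the hyperplane `nᗮ` along the direction `w`. -/
noncomputable def obliqueProj (n w : E) : E →L[ℝ] (ℝ ∙ n)ᗮ :=
  (ℝ ∙ n)ᗮ.orthogonalProjectionOnto ∘L
    (ContinuousLinearMap.id ℝ E - (innerSL ℝ n).smulRight w)

/-- The normalization of `w` makes the right-hand side orthogonal to `n` already; the orthogonal
projection in the definition only provides the codomain. -/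
lemma coe_obliqueProj {n w : E} (hw : ⟪n, w⟫ = 1) (q : E) :
    (obliqueProj n w q : E) = q - ⟪n, q⟫ • w := by
  have : q - ⟪n, q⟫ • w ∈ (ℝ ∙ n)ᗮ := by
    rw [mem_orthogonal_singleton_iff_inner_right, inner_sub_right, inner_smul_right, hw]
    ring
  simpa [obliqueProj] using
    congrArg Subtype.val ((ℝ ∙ n)ᗮ.orthogonalProjectionOnto_mem_subspace_eq_self ⟨_, this⟩)

lemma obliqueProj_add_smul {n w : E} (hw : ⟪n, w⟫ = 1) (y : (ℝ ∙ n)ᗮ) (t : ℝ) :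
    obliqueProj n w (y + t • w) = y := by
  have hy : ⟪n, (y : E)⟫ = 0 := mem_orthogonal_singleton_iff_inner_right.1 y.2
  ext
  rw [coe_obliqueProj hw, inner_add_right, inner_smul_right, hw, hy]
  simp

lemma obliqueProj_add_inner_smul {n w : E} (hw : ⟪n, w⟫ = 1) (q : E) :
    (obliqueProj n w q : E) + ⟪n, q⟫ • w = q := by
  rw [coe_obliqueProj hw, sub_add_cancel]

variable [FiniteDimensional ℝ E] [MeasurableSpace E] [BorelSpace E]

/-- For `w = n` this is the orthogonal decomposition. In general `w - n ∈ nᗮ`, so the map is that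
decomposition preceded by a shear, which translates each slice and preserves volume. -/
lemma measurePreserving_add_smul {n w : E} (hn : ‖n‖ = 1) (hw : ⟪n, w⟫ = 1) :
    MeasurePreserving (fun p : ℝ × (ℝ ∙ n)ᗮ => (p.2 : E) + p.1 • w)
      (volume.prod volume) volume := by
  have h₁ : MeasurePreserving
      (Prod.map (LinearIsometryEquiv.toSpanUnitSingleton (𝕜 := ℝ) n hn) (id : (ℝ ∙ n)ᗮ → _))
      (volume.prod volume) (volume.prod volume) :=
    (LinearIsometryEquiv.measurePreserving _).prod (MeasurePreserving.id _)
  have h₂ := (WithLp.volume_preserving_toLp (ℝ ∙ n) (ℝ ∙ n)ᗮ).comp h₁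
  have h₃ := ((ℝ ∙ n).orthogonalDecomposition.symm.measurePreserving).comp h₂
  have hmem : w - n ∈ (ℝ ∙ n)ᗮ := by
    rw [mem_orthogonal_singleton_iff_inner_right, inner_sub_right, hw,
      real_inner_self_eq_norm_sq, hn]
    norm_num
  have h₄ : MeasurePreserving
      (fun p : ℝ × (ℝ ∙ n)ᗮ => (p.1, p.2 + p.1 • (⟨w - n, hmem⟩ : (ℝ ∙ n)ᗮ)))
      (volume.prod volume) (volume.prod volume) := by
    refine (MeasurePreserving.id (volume : Measure ℝ)).skew_product
      (g := fun t y => y + t • (⟨w - n, hmem⟩ : (ℝ ∙ n)ᗮ)) ?_ ?_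
    · exact (by fun_prop : Continuous fun p : ℝ × (ℝ ∙ n)ᗮ =>
        p.2 + p.1 • (⟨w - n, hmem⟩ : (ℝ ∙ n)ᗮ)).measurable
    · exact Eventually.of_forall fun t => (measurePreserving_add_right volume _).map_eq
  convert! h₃.comp h₄ using 1
  ext p
  simp [smul_sub]
  abel

end ObliqueProjection

/-! ### The fundamental theorem of calculus along transversal lines -/

section LineFlux

/-- The fundamental theorem of calculus on the negative set of a function that is increasing on an
interval, for a function supported in this interval: a zero of the increasing function. -/
lemma setIntegral_deriv_neg_of_zero {g h : ℝ → ℝ} {I : Set ℝ} {τ : ℝ} (hg : ContDiff ℝ 1 g)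
    (hgc : HasCompactSupport g) (hgI : tsupport g ⊆ I) (hh : StrictMonoOn h I) (hτ : τ ∈ I)
    (h0 : h τ = 0) : ∫ t in {t | t ∈ I ∧ h t < 0}, deriv g t = g τ := by
  rw [← hgc.integral_Iic_deriv_eq hg τ, integral_Iic_eq_integral_Iio]
  have hset : {t | t ∈ I ∧ h t < 0} = I ∩ Iio τ := by
    ext t
    refine and_congr_right fun ht => ?_
    rw [← h0, hh.lt_iff_lt ht hτ, mem_Iio]
  rw [hset, inter_comm]
  refine (setIntegral_eq_of_subset_of_forall_sdiff_eq_zero measurableSet_Iio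
    inter_subset_left ?_).symm
  rintro t ⟨ht, ht'⟩
  refine image_eq_zero_of_notMem_tsupport fun hmem => ht' ⟨ht, hgI ?_⟩
  exact tsupport_deriv_subset hmem

/-- The fundamental theorem of calculus on the negative set of a function that is continuous and
without zeros on an interval, for a function supported in this interval. -/
lemma setIntegral_deriv_neg_of_ne_zero {g h : ℝ → ℝ} {I : Set ℝ} (hg : ContDiff ℝ 1 g)
    (hgc : HasCompactSupport g) (hgI : tsupport g ⊆ I) (hI : IsPreconnected I)
    (hh : ContinuousOn h I) (h0 : ∀ t ∈ I, h t ≠ 0) :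
    ∫ t in {t | t ∈ I ∧ h t < 0}, deriv g t = 0 := by
  by_cases hneg : ∃ t ∈ I, h t < 0
  · obtain ⟨t₀, ht₀, hlt⟩ := hneg
    have hset : {t | t ∈ I ∧ h t < 0} = I := by
      refine Subset.antisymm (fun t ht => ht.1) fun t ht => ⟨ht, ?_⟩
      -- Without zeros there is no sign change, so a single negative value makes the function
      -- negative on all of `I`.
      by_contra! hge
      obtain ⟨s, hs, hs0⟩ := hI.intermediate_value ht₀ ht hh ⟨hlt.le, hge⟩
      exact h0 s hs hs0
    rw [hset, setIntegral_eq_integral_of_forall_compl_eq_zero]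
    · have hd : Integrable (deriv g) :=
        (hg.continuous_deriv le_rfl).integrable_of_hasCompactSupport hgc.deriv
      exact integral_eq_zero_of_hasDerivAt_of_integrable
        (fun t => (hg.differentiable one_ne_zero t).hasDerivAt) hd
        (hg.continuous.integrable_of_hasCompactSupport hgc)
    · intro t ht
      exact image_eq_zero_of_notMem_tsupport fun hmem => ht (hgI (tsupport_deriv_subset hmem))
  · have hset : {t | t ∈ I ∧ h t < 0} = ∅ :=
      eq_empty_of_forall_notMem fun t ht => hneg ⟨t, ht.1, ht.2⟩
    rw [hset, setIntegral_empty]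

variable {E : Type*} [NormedAddCommGroup E] [InnerProductSpace ℝ E]

/-- Two points with the same projection differ by a multiple of `w`, along which `φ` increases
strictly and so cannot vanish twice. -/
lemma injOn_obliqueProj {n w : E} (hw : ⟪n, w⟫ = 1) {W : Set E} {φ : E → ℝ}
    (hmono : ∀ q ∈ W, ∀ t > (0 : ℝ), q + t • w ∈ W → φ q < φ (q + t • w)) :
    InjOn (obliqueProj n w) {q | q ∈ W ∧ φ q = 0} := by
  have key : ∀ q ∈ W, ∀ q' ∈ W, φ q = 0 → φ q' = 0 → obliqueProj n w q = obliqueProj n w q' →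
      ¬ ⟪n, q⟫ < ⟪n, q'⟫ := by
    intro q hq q' hq' h0 h0' hP hlt
    have hsum : q + (⟪n, q'⟫ - ⟪n, q⟫) • w = q' :=
      calc q + (⟪n, q'⟫ - ⟪n, q⟫) • w = (q - ⟪n, q⟫ • w) + ⟪n, q'⟫ • w := by rw [sub_smul]; abel
        _ = q' := by rw [← coe_obliqueProj hw, hP, obliqueProj_add_inner_smul hw]
    have := hmono q hq (⟪n, q'⟫ - ⟪n, q⟫) (sub_pos.2 hlt) (by rwa [hsum])
    rw [hsum, h0, h0'] at this
    exact lt_irrefl _ this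
  rintro q ⟨hq, h0⟩ q' ⟨hq', h0'⟩ hP
  have h := le_antisymm (not_lt.1 (key q' hq' q hq h0' h0 hP.symm))
    (not_lt.1 (key q hq q' hq' h0 h0' hP))
  rw [← obliqueProj_add_inner_smul hw q, ← obliqueProj_add_inner_smul hw q', h, hP]

variable [FiniteDimensional ℝ E] [MeasurableSpace E] [BorelSpace E]

/-- The integral of a directional derivative over the region below a hypersurface that is
transversal to the direction. -/
lemma setIntegral_fderiv_eq_setIntegral_obliqueProj {n w : E} (hn : ‖n‖ = 1) (hw : ⟪n, w⟫ = 1)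
    {W : Set E} {φ f : E → ℝ} (hWo : IsOpen W) (hWc : Convex ℝ W) (hφ : ContinuousOn φ W)
    (hmono : ∀ q ∈ W, ∀ t > (0 : ℝ), q + t • w ∈ W → φ q < φ (q + t • w))
    (hf : ContDiff ℝ 1 f) (hfc : HasCompactSupport f) (hfW : tsupport f ⊆ W)
    (hPm : MeasurableSet (obliqueProj n w '' {q | q ∈ W ∧ φ q = 0})) :
    ∫ q in {q | q ∈ W ∧ φ q < 0}, fderiv ℝ f q w =
      ∫ y in obliqueProj n w '' {q | q ∈ W ∧ φ q = 0},
        f (Function.invFunOn (obliqueProj n w) {q | q ∈ W ∧ φ q = 0} y) := by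
  set Z := {q | q ∈ W ∧ φ q = 0} with hZ
  have hA : IsOpen {q | q ∈ W ∧ φ q < 0} := hφ.isOpen_inter_preimage hWo isOpen_Iio
  have hcont : Continuous fun q => fderiv ℝ f q w :=
    (hf.continuous_fderiv one_ne_zero).clm_apply continuous_const
  have hint : Integrable (indicator {q | q ∈ W ∧ φ q < 0} fun q => fderiv ℝ f q w) := by
    refine Integrable.indicator ?_ hA.measurableSet
    exact hcont.integrable_of_hasCompactSupport (hfc.fderiv_apply ℝ w)
  have hmp := measurePreserving_add_smul hn hw
  have hint' : Integrable (fun p : ℝ × (ℝ ∙ n)ᗮ => indicator {q | q ∈ W ∧ φ q < 0}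
      (fun q => fderiv ℝ f q w) ((p.2 : E) + p.1 • w)) (volume.prod volume) :=
    (hmp.integrable_comp hint.aestronglyMeasurable).2 hint
  rw [← integral_indicator hA.measurableSet, ← hmp.map_eq,
    integral_map hmp.measurable.aemeasurable (by rw [hmp.map_eq]; exact hint.aestronglyMeasurable),
    integral_prod_symm _ hint', ← integral_indicator hPm]
  -- Fubini has reduced the claim to the line `y + t w`. If the line meets the zero set, it does so
  -- once and contributes the value of `f` there; otherwise `φ` has a constant sign on the line
  -- inside `W` and the contribution is zero.
  congr 1 with y
  have hline : Continuous fun t : ℝ => (y : E) + t • w := by fun_prop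
  have hg : ContDiff ℝ 1 fun t : ℝ => f ((y : E) + t • w) := hf.comp (by fun_prop)
  have hw0 : w ≠ 0 := by rintro rfl; simp at hw
  have hce : IsClosedEmbedding fun t : ℝ => (y : E) + t • w :=
    (Homeomorph.addLeft (y : E)).isClosedEmbedding.comp (isClosedEmbedding_smul_left hw0)
  have hgc : HasCompactSupport fun t : ℝ => f ((y : E) + t • w) :=
    hfc.comp_isClosedEmbedding hce
  have hderiv : ∀ t : ℝ, deriv (fun t : ℝ => f ((y : E) + t • w)) t
      = fderiv ℝ f ((y : E) + t • w) w := by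
    intro t
    have h1 : HasDerivAt (fun t : ℝ => (y : E) + t • w) w t := by
      simpa using ((hasDerivAt_id t).smul_const w).const_add (y : E)
    exact ((hf.differentiable one_ne_zero _).hasFDerivAt.comp_hasDerivAt t h1).deriv
  set I := (fun t : ℝ => (y : E) + t • w) ⁻¹' W with hI
  have hgI : tsupport (fun t : ℝ => f ((y : E) + t • w)) ⊆ I :=
    (tsupport_comp_subset_preimage f hline).trans (preimage_mono hfW)
  have hLHS : ∫ t : ℝ, indicator {q | q ∈ W ∧ φ q < 0} (fun q => fderiv ℝ f q w) ((y : E) + t • w)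
      = ∫ t in {t : ℝ | t ∈ I ∧ φ ((y : E) + t • w) < 0},
          deriv (fun t : ℝ => f ((y : E) + t • w)) t := by
    have hm : MeasurableSet {t : ℝ | t ∈ I ∧ φ ((y : E) + t • w) < 0} :=
      (hA.preimage hline).measurableSet
    rw [← integral_indicator hm]
    congr 1 with t
    by_cases ht : (y : E) + t • w ∈ {q | q ∈ W ∧ φ q < 0}
    · rw [indicator_of_mem ht, indicator_of_mem (by exact ht), hderiv]
    · rw [indicator_of_notMem ht, indicator_of_notMem (by exact ht)]
  rw [hLHS]
  have hsm : StrictMonoOn (fun t : ℝ => φ ((y : E) + t • w)) I := by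
    intro s hs t ht hst
    have := hmono _ hs (t - s) (sub_pos.2 hst) (by
      have ht' : (y : E) + t • w ∈ W := ht
      simpa [sub_smul, add_assoc] using ht')
    simpa [sub_smul, add_assoc] using this
  by_cases hy : y ∈ obliqueProj n w '' Z
  · rw [indicator_of_mem hy]
    have hG := Function.invFunOn_mem hy
    have hPG := Function.invFunOn_eq hy
    set q := Function.invFunOn (obliqueProj n w) Z y
    have hq := obliqueProj_add_inner_smul hw q
    rw [hPG] at hq
    have hqI : ⟪n, q⟫ ∈ I := by
      change (y : E) + ⟪n, q⟫ • w ∈ W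
      rw [hq]; exact hG.1
    rw [setIntegral_deriv_neg_of_zero hg hgc hgI hsm hqI (by simp only [hq]; exact hG.2), hq]
  · rw [indicator_of_notMem hy]
    refine setIntegral_deriv_neg_of_ne_zero hg hgc hgI ?_ ?_ ?_
    · have : Convex ℝ I := by
        have := hWc.affine_preimage (AffineMap.lineMap (y : E) ((y : E) + w) : ℝ →ᵃ[ℝ] E)
        convert! this using 1
        ext t
        simp [hI, AffineMap.lineMap_apply, add_comm]
      exact this.isPreconnected
    · exact hφ.comp hline.continuousOn (fun t ht => ht)
    · intro t ht h0
      exact hy ⟨(y : E) + t • w, ⟨ht, h0⟩, obliqueProj_add_smul hw y t⟩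

end LineFlux

/-! ### Change of variables for Hausdorff measures under near-isometries -/

section HausdorffComparison

variable {X Y : Type*} [MetricSpace X] [MeasurableSpace X] [BorelSpace X]
  [MetricSpace Y] [MeasurableSpace Y] [BorelSpace Y]

lemma LipschitzOnWith.euclideanHausdorffMeasure_image_le {K : ℝ≥0} {f : X → Y} {s : Set X}
    (h : LipschitzOnWith K f s) (d : ℕ) : μHE[d] (f '' s) ≤ (K : ℝ≥0∞) ^ d * μHE[d] s := by
  simp only [Measure.euclideanHausdorffMeasure_def, Measure.smul_apply, ENNReal.smul_def,
    smul_eq_mul]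
  rw [mul_left_comm]
  gcongr
  simpa using h.hausdorffMeasure_image_le (d := d) (by positivity)

/-- For a nonnegative integrand each integral is at most `K` times the other; if the `μ`-integral is
the smaller one, the difference is at most `K - 1` times it, hence at most `K - 1` times the
`ν`-integral. The bounds for the positive and the negative part add up to `∫ |f|`. -/
lemma abs_integral_sub_integral_le_of_measure_le {X : Type*} [MeasurableSpace X] {μ ν : Measure X} {K : ℝ≥0} (hK : 1 ≤ K)
    (h₁ : μ ≤ K • ν) (h₂ : ν ≤ K • μ) {f : X → ℝ} (hf : Integrable f ν) :
    |∫ x, f x ∂μ - ∫ x, f x ∂ν| ≤ (K - 1) * ∫ x, |f x| ∂ν := by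
  have hK' : (1 : ℝ) ≤ K := hK
  have hfμ : Integrable f μ := (hf.smul_measure_nnreal (c := K)).mono_measure h₁
  have key : ∀ g : X → ℝ, (∀ x, 0 ≤ g x) → Integrable g ν → Integrable g μ →
      |∫ x, g x ∂μ - ∫ x, g x ∂ν| ≤ (K - 1) * ∫ x, g x ∂ν := by
    intro g hg hgν hgμ
    have e₁ : ∫ x, g x ∂μ ≤ K * ∫ x, g x ∂ν := by
      have := integral_mono_measure h₁ (Eventually.of_forall hg) hgν.smul_measure_nnreal
      simpa [integral_smul_nnreal_measure, NNReal.smul_def] using this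
    have e₂ : ∫ x, g x ∂ν ≤ K * ∫ x, g x ∂μ := by
      have := integral_mono_measure h₂ (Eventually.of_forall hg) hgμ.smul_measure_nnreal
      simpa [integral_smul_nnreal_measure, NNReal.smul_def] using this
    have hν : 0 ≤ ∫ x, g x ∂ν := integral_nonneg hg
    have hμ : 0 ≤ ∫ x, g x ∂μ := integral_nonneg hg
    rw [abs_le]
    constructor
    · by_cases hle : ∫ x, g x ∂μ ≤ ∫ x, g x ∂ν
      · nlinarith
      · nlinarith
    · linarith
  have hp := key (fun x => max (f x) 0) (fun x => le_max_right _ _) hf.pos_part hfμ.pos_part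
  have hn := key (fun x => max (-f x) 0) (fun x => le_max_right _ _) hf.neg_part hfμ.neg_part
  have hdec : ∀ x, f x = max (f x) 0 - max (-f x) 0 := fun x => by
    rcases le_total 0 (f x) with h | h <;> simp [h]
  have habs : ∀ x, |f x| = max (f x) 0 + max (-f x) 0 := fun x => by
    rcases le_total 0 (f x) with h | h <;> simp [h, abs_of_nonneg, abs_of_nonpos]
  have e₁ : ∫ x, f x ∂μ = ∫ x, max (f x) 0 ∂μ - ∫ x, max (-f x) 0 ∂μ := by
    rw [← integral_sub hfμ.pos_part hfμ.neg_part]; exact integral_congr_ae (ae_of_all _ hdec)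
  have e₂ : ∫ x, f x ∂ν = ∫ x, max (f x) 0 ∂ν - ∫ x, max (-f x) 0 ∂ν := by
    rw [← integral_sub hf.pos_part hf.neg_part]; exact integral_congr_ae (ae_of_all _ hdec)
  have e₃ : ∫ x, |f x| ∂ν = ∫ x, max (f x) 0 ∂ν + ∫ x, max (-f x) 0 ∂ν := by
    rw [← integral_add hf.pos_part hf.neg_part]; exact integral_congr_ae (ae_of_all _ habs)
  rw [e₁, e₂, e₃, mul_add]
  rw [abs_le] at hp hn ⊢
  constructor <;> linarith [hp.1, hp.2, hn.1, hn.2]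

lemma map_restrict_image_apply {P : X → Y} {G : Y → X} {Z : Set X} (hPZ : MeasurableSet (P '' Z))
    (hG : ∀ q ∈ Z, G (P q) = q) (hGc : ContinuousOn G (P '' Z)) (μ : Measure Y) {A : Set X}
    (hA : MeasurableSet A) : (μ.restrict (P '' Z)).map G A = μ (P '' (Z ∩ A)) := by
  have himg : G ⁻¹' A ∩ P '' Z = P '' (Z ∩ A) := by
    ext y
    constructor
    · rintro ⟨hy, q, hq, rfl⟩
      rw [mem_preimage, hG q hq] at hy
      exact ⟨q, ⟨hq, hy⟩, rfl⟩
    · rintro ⟨q, ⟨hq, hqA⟩, rfl⟩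
      exact ⟨by rwa [mem_preimage, hG q hq], q, hq, rfl⟩
  rw [Measure.map_apply_of_aemeasurable (hGc.aemeasurable hPZ) hA,
    Measure.restrict_apply' hPZ, himg]

lemma restrict_le_smul_map_restrict_image {P : X → Y} {G : Y → X} {Z : Set X} {K : ℝ≥0}
    (hPZ : MeasurableSet (P '' Z)) (hG : ∀ q ∈ Z, G (P q) = q)
    (hGL : LipschitzOnWith K G (P '' Z)) (d : ℕ) :
    μHE[d].restrict Z ≤ K ^ d • (μHE[d].restrict (P '' Z)).map G := by
  refine Measure.le_iff.2 fun A hA => ?_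
  rw [Measure.smul_apply, map_restrict_image_apply hPZ hG hGL.continuousOn _ hA,
    Measure.restrict_apply hA, ENNReal.smul_def, smul_eq_mul, inter_comm A Z]
  have h1 := (hGL.mono (image_mono inter_subset_left)).euclideanHausdorffMeasure_image_le
    (s := P '' (Z ∩ A)) d
  have h2 : G '' (P '' (Z ∩ A)) = Z ∩ A := by
    rw [image_image]
    conv_rhs => rw [← image_id (Z ∩ A)]
    exact image_congr fun q hq => hG q hq.1
  rw [h2] at h1
  simpa using h1

/-- Change of variables for Hausdorff measures along a map that is close to an isometry. -/
lemma abs_setIntegral_image_sub_setIntegral_le {P : X → Y} {G : Y → X} {Z : Set X} {K : ℝ≥0}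
    (hK : 1 ≤ K) (hPZ : MeasurableSet (P '' Z))
    (hG : ∀ q ∈ Z, G (P q) = q) (hPL : LipschitzOnWith K P Z) (hGL : LipschitzOnWith K G (P '' Z))
    (d : ℕ) {f : X → ℝ} (hfc : Continuous f) (hf : IntegrableOn f Z μHE[d]) :
    |∫ y in P '' Z, f (G y) ∂μHE[d] - ∫ q in Z, f q ∂μHE[d]| ≤
      (K ^ d - 1) * ∫ q in Z, |f q| ∂μHE[d] := by
  have hGm : AEMeasurable G (μHE[d].restrict (P '' Z)) := hGL.continuousOn.aemeasurable hPZ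
  rw [← integral_map hGm hfc.aestronglyMeasurable]
  have := abs_integral_sub_integral_le_of_measure_le (K := K ^ d)
    (μ := (μHE[d].restrict (P '' Z)).map G) (ν := μHE[d].restrict Z)
    (one_le_pow₀ hK) ?_ (restrict_le_smul_map_restrict_image hPZ hG hGL d) hf
  · simpa using this
  · refine Measure.le_iff.2 fun A hA => ?_
    rw [map_restrict_image_apply hPZ hG hGL.continuousOn _ hA, Measure.smul_apply,
      Measure.restrict_apply hA, ENNReal.smul_def, smul_eq_mul, inter_comm A Z]
    simpa using (hPL.mono inter_subset_left).euclideanHausdorffMeasure_image_le (s := Z ∩ A) d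

end HausdorffComparison

/-! ### Nearly flat level sets of `C¹` functions -/

section Chart

variable {E : Type*} [NormedAddCommGroup E] [InnerProductSpace ℝ E]

lemma norm_sub_obliqueProj_sub_le {n w : E} (hw : ⟪n, w⟫ = 1) {κ : ℝ} {q q' : E}
    (h : |⟪n, q - q'⟫| * ‖w‖ ≤ κ * ‖q - q'‖) :
    ‖(q - q') - (obliqueProj n w (q - q') : E)‖ ≤ κ * ‖q - q'‖ := by
  rw [coe_obliqueProj hw, sub_sub_cancel, norm_smul, Real.norm_eq_abs]
  exact h

lemma lipschitzOnWith_obliqueProj {n w : E} (hw : ⟪n, w⟫ = 1) {κ : ℝ≥0} {Z : Set E}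
    (h : ∀ q ∈ Z, ∀ q' ∈ Z, |⟪n, q - q'⟫| * ‖w‖ ≤ κ * ‖q - q'‖) :
    LipschitzOnWith (1 + 2 * κ) (obliqueProj n w) Z := by
  refine LipschitzOnWith.of_dist_le_mul fun q hq q' hq' => ?_
  rw [dist_eq_norm, dist_eq_norm, ← map_sub]
  have h1 := norm_sub_obliqueProj_sub_le hw (h q hq q' hq')
  have h2 := norm_sub_norm_le (obliqueProj n w (q - q') : E) (q - q')
  rw [norm_sub_rev (obliqueProj n w (q - q') : E) (q - q')] at h2
  have h3 : (0 : ℝ) ≤ κ * ‖q - q'‖ := by positivity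
  change ‖(obliqueProj n w (q - q') : E)‖ ≤ _
  push_cast
  linarith

/-- The projection moves differences by at most the fraction `κ`, so the inverse has constant `1 /
(1 - κ) ≤ 1 + 2κ` for `κ ≤ 1/2`. The projection itself would allow `1 + κ`; a common constant serves
both directions. -/
lemma lipschitzOnWith_invFunOn_obliqueProj {n w : E} (hw : ⟪n, w⟫ = 1) {κ : ℝ≥0} {Z : Set E}
    (hκ : κ ≤ 1 / 2) (h : ∀ q ∈ Z, ∀ q' ∈ Z, |⟪n, q - q'⟫| * ‖w‖ ≤ κ * ‖q - q'‖) :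
    LipschitzOnWith (1 + 2 * κ) (Function.invFunOn (obliqueProj n w) Z) (obliqueProj n w '' Z) := by
  refine LipschitzOnWith.of_dist_le_mul fun y hy y' hy' => ?_
  have m := Function.invFunOn_mem hy
  have m' := Function.invFunOn_mem hy'
  have e := Function.invFunOn_eq hy
  have e' := Function.invFunOn_eq hy'
  set q := Function.invFunOn (obliqueProj n w) Z y
  set q' := Function.invFunOn (obliqueProj n w) Z y'
  rw [← e, ← e', dist_eq_norm, dist_eq_norm, ← map_sub]
  have h1 := norm_sub_obliqueProj_sub_le hw (h q m q' m')
  have h2 := norm_sub_norm_le (q - q') (obliqueProj n w (q - q') : E)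
  change _ ≤ _ * ‖(obliqueProj n w (q - q') : E)‖
  have hκ' : (κ : ℝ) ≤ 1 / 2 := by exact_mod_cast hκ
  have hκ0 : (0 : ℝ) ≤ κ := κ.2
  push_cast
  set a := ‖q - q'‖
  set b := ‖(obliqueProj n w (q - q') : E)‖
  have ha : 0 ≤ a := norm_nonneg _
  have h4 : (1 - κ) * a ≤ b := by linarith
  have h3 : (1 + 2 * (κ : ℝ)) * ((1 - κ) * a) ≤ (1 + 2 * κ) * b := by gcongr
  have h5 : 0 ≤ κ * (1 - 2 * κ) * a := by
    have : 0 ≤ 1 - 2 * (κ : ℝ) := by linarith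
    positivity
  nlinarith

variable [CompleteSpace E]

/-- Near a point where its gradient does not vanish, a `C¹` function is almost affine. -/
lemma exists_ball_abs_sub_inner_le {U : Set E} {φ : E → ℝ} {p : E} (hU : IsOpen U) (hp : p ∈ U)
    (hφ : ContDiffOn ℝ 1 φ U) (hN : gradient φ p ≠ 0) {η : ℝ} (hη : 0 < η) :
    ∃ r > 0, Metric.ball p r ⊆ U ∧ ∀ q ∈ Metric.ball p r, ∀ q' ∈ Metric.ball p r,
      |φ q - φ q' - ‖gradient φ p‖ * ⟪‖gradient φ p‖⁻¹ • gradient φ p, q - q'⟫| ≤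
        η * ‖gradient φ p‖ * ‖q - q'‖ := by
  -- Strict differentiability is what allows both `q` and `q'` to vary.
  have hs : HasStrictFDerivAt φ (fderiv ℝ φ p) p :=
    (hφ.contDiffAt (hU.mem_nhds hp)).hasStrictFDerivAt one_ne_zero
  have hN' : 0 < ‖gradient φ p‖ := norm_pos_iff.2 hN
  have hev := hs.isLittleO.def (mul_pos hη hN')
  rw [nhds_prod_eq] at hev
  obtain ⟨t, ht, htt⟩ := mem_prod_same_iff.1 hev
  obtain ⟨r, hr, hsub⟩ := Metric.mem_nhds_iff.1 (inter_mem ht (hU.mem_nhds hp))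
  refine ⟨r, hr, fun q hq => (hsub hq).2, fun q hq q' hq' => ?_⟩
  have := htt (mk_mem_prod (hsub hq).1 (hsub hq').1)
  rw [real_inner_smul_left, mul_inv_cancel_left₀ hN'.ne', inner_gradient_left,
    ← Real.norm_eq_abs]
  exact this

end Chart

/-! ### Gauss-Green near a boundary point, for a transversal direction -/

section LocalGaussGreen

variable {E : Type*} [NormedAddCommGroup E] [InnerProductSpace ℝ E]

lemma abs_inner_le_of_almost_affine {φ : E → ℝ} {W : Set E} {n : E} {a η : ℝ} (ha : 0 < a)
    (h : ∀ q ∈ W, ∀ q' ∈ W, |φ q - φ q' - a * ⟪n, q - q'⟫| ≤ η * a * ‖q - q'‖) {q q' : E}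
    (hq : q ∈ W) (hq' : q' ∈ W) (h0 : φ q = φ q') : |⟪n, q - q'⟫| ≤ η * ‖q - q'‖ := by
  have := h q hq q' hq'
  rw [h0, sub_self, zero_sub, abs_neg, abs_mul, abs_of_pos ha] at this
  refine le_of_mul_le_mul_left ?_ ha
  linarith

/-- The linear part grows by `a t` and the error is at most `η a t ‖w‖`. -/
lemma lt_of_almost_affine {φ : E → ℝ} {W : Set E} {n w : E} {a η : ℝ} (ha : 0 < a)
    (h : ∀ q ∈ W, ∀ q' ∈ W, |φ q - φ q' - a * ⟪n, q - q'⟫| ≤ η * a * ‖q - q'‖)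
    (hw : ⟪n, w⟫ = 1) (hη : η * ‖w‖ < 1) :
    ∀ q ∈ W, ∀ t > (0 : ℝ), q + t • w ∈ W → φ q < φ (q + t • w) := by
  intro q hq t ht hqt
  have := (abs_le.1 (h _ hqt q hq)).1
  rw [add_sub_cancel_left, inner_smul_right, hw, norm_smul, Real.norm_of_nonneg ht.le] at this
  have h2 : 0 < a * t * (1 - η * ‖w‖) := by
    have : 0 < 1 - η * ‖w‖ := by linarith
    positivity
  nlinarith

variable [FiniteDimensional ℝ E]

lemma continuousOn_normalized_gradient {U : Set E} {φ : E → ℝ} (hU : IsOpen U)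
    (hφ : ContDiffOn ℝ 1 φ U) (hN : ∀ x ∈ U, gradient φ x ≠ 0) :
    ContinuousOn (fun x => ‖gradient φ x‖⁻¹ • gradient φ x) U := by
  have hg : ContinuousOn (gradient φ) U := by
    have h1 : ContinuousOn (fderiv ℝ φ) U := hφ.continuousOn_fderiv_of_isOpen hU le_rfl
    exact (InnerProductSpace.toDual ℝ E).symm.continuous.comp_continuousOn h1
  exact (hg.norm.inv₀ fun x hx => norm_ne_zero_iff.2 (hN x hx)).smul hg

variable [MeasurableSpace E] [BorelSpace E]

/-- This is the Lusin-Souslin theorem. -/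
lemma measurableSet_image_of_injOn {F : Type*} [NormedAddCommGroup F] [MeasurableSpace F]
    [BorelSpace F] [SecondCountableTopology F] {P : E → F} {Z : Set E} (hZ : MeasurableSet Z)
    (hP : Continuous P) (hinj : InjOn P Z) : MeasurableSet (P '' Z) :=
  hZ.image_of_continuousOn_injOn hP.continuousOn hinj

/-- A bounded almost flat hypersurface has finite measure. -/
lemma euclideanHausdorffMeasure_lt_top_of_obliqueProj {n w : E} (hn : n ≠ 0) (hw : ⟪n, w⟫ = 1)
    {κ : ℝ≥0} {Z : Set E} (hκ : κ ≤ 1 / 2) (hb : Bornology.IsBounded Z)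
    (h : ∀ q ∈ Z, ∀ q' ∈ Z, |⟪n, q - q'⟫| * ‖w‖ ≤ κ * ‖q - q'‖)
    (hinj : InjOn (obliqueProj n w) Z) :
    μHE[Module.finrank ℝ E - 1] Z < ∞ := by
  have hL := lipschitzOnWith_invFunOn_obliqueProj hw hκ h
  have himg : Function.invFunOn (obliqueProj n w) Z '' (obliqueProj n w '' Z) = Z := by
    rw [image_image]
    conv_rhs => rw [← image_id Z]
    exact image_congr fun q hq => hinj.leftInvOn_invFunOn hq
  have hle := hL.euclideanHausdorffMeasure_image_le (Module.finrank ℝ E - 1)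
  rw [himg] at hle
  have hfr : Module.finrank ℝ (ℝ ∙ n)ᗮ = Module.finrank ℝ E - 1 := by
    have := (ℝ ∙ n).finrank_add_finrank_orthogonal
    rw [finrank_span_singleton hn] at this
    omega
  refine hle.trans_lt (ENNReal.mul_lt_top (ENNReal.pow_lt_top ENNReal.coe_lt_top) ?_)
  rw [← hfr, InnerProductSpace.euclideanHausdorffMeasure_eq_volume]
  exact ((obliqueProj n w).lipschitz.isBounded_image hb).measure_lt_top

lemma exists_pow_sub_one_le {ε : ℝ} (hε : 0 < ε) (d : ℕ) :
    ∃ κ : ℝ≥0, 0 < κ ∧ κ ≤ 1 / 4 ∧ (1 + 2 * (κ : ℝ)) ^ d - 1 ≤ ε := by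
  have : Tendsto (fun κ : ℝ => (1 + 2 * κ) ^ d - 1) (𝓝[>] 0) (𝓝 ((1 + 2 * 0) ^ d - 1)) :=
    ((by fun_prop : Continuous fun κ : ℝ => (1 + 2 * κ) ^ d - 1).tendsto 0).mono_left
      nhdsWithin_le_nhds
  have h1 := this.eventually_le_const (u := ε) (by simpa using hε)
  have h2 : ∀ᶠ κ : ℝ in 𝓝[>] 0, κ ≤ 1 / 4 :=
    nhdsWithin_le_nhds (Iic_mem_nhds (by norm_num))
  obtain ⟨κ, hκ1, hκ2, hκ3⟩ := (h1.and (h2.and self_mem_nhdsWithin)).exists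
  lift κ to ℝ≥0 using le_of_lt hκ3
  exact ⟨κ, by exact_mod_cast hκ3, by exact_mod_cast hκ2, hκ1⟩

/-- Gauss-Green near a boundary point, for a transversal direction and up to a small relative
error. -/
lemma exists_nhds_abs_gaussGreen_le_of_transversal {Ω Γ U : Set E} {ν : E → E} {φ : E → ℝ} {p : E}
    (hΓm : MeasurableSet Γ) (hU : IsOpen U) (hp : p ∈ Γ) (hpU : p ∈ U) (hφ : ContDiffOn ℝ 1 φ U)
    (hN : ∀ x ∈ U, gradient φ x ≠ 0) (hΓ : Γ ∩ U = {x | x ∈ U ∧ φ x = 0})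
    (hΩ : Ω ∩ U = {x | x ∈ U ∧ φ x < 0}) (hΩm : MeasurableSet Ω)
    (hν : ∀ x ∈ Γ ∩ U, ν x = ‖gradient φ x‖⁻¹ • gradient φ x)
    {w : E} (hw : ⟪ν p, w⟫ = 1) {ε : ℝ} (hε : 0 < ε) :
    ∃ W, IsOpen W ∧ p ∈ W ∧ ∀ f : E → ℝ, ContDiff ℝ 1 f → HasCompactSupport f → tsupport f ⊆ W →
      IntegrableOn (fun q => f q * ⟪w, ν q⟫) Γ μHE[Module.finrank ℝ E - 1] ∧
      |(∫ q in Ω, fderiv ℝ f q w) -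
          ∫ q in Γ, f q * ⟪w, ν q⟫ ∂μHE[Module.finrank ℝ E - 1]| ≤
        ε * ∫ q in Γ, |f q| ∂μHE[Module.finrank ℝ E - 1] := by
  set d := Module.finrank ℝ E - 1 with hd
  have hνp := hν p ⟨hp, hpU⟩
  have ha : 0 < ‖gradient φ p‖ := norm_pos_iff.2 (hN p hpU)
  have hn : ‖ν p‖ = 1 := by
    rw [hνp, norm_smul, norm_inv, norm_norm, inv_mul_cancel₀ ha.ne']
  have hn0 : ν p ≠ 0 := norm_ne_zero_iff.1 (by rw [hn]; exact one_ne_zero)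
  have hw0 : 0 < ‖w‖ := norm_pos_iff.2 (by rintro rfl; simp at hw)
  -- One half of `ε` pays for the distortion `(1 + 2κ)^d - 1` of the surface measure under the
  -- projection, the other half for replacing `⟪w, ν q⟫` by its value `1` at `p`.
  obtain ⟨κ, hκ0, hκ4, hκd⟩ := exists_pow_sub_one_le (half_pos hε) d
  have hκ4' : (κ : ℝ) ≤ 1 / 4 := by exact_mod_cast hκ4
  -- With this tolerance `η ‖w‖ = κ`, which yields both the monotonicity along `w` (as `κ < 1`) and
  -- the flatness bound with constant `κ`.
  have hη : 0 < (κ : ℝ) / ‖w‖ := div_pos hκ0 hw0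
  obtain ⟨r₁, hr₁, hsub₁, haff⟩ := exists_ball_abs_sub_inner_le hU hpU hφ (hN p hpU) hη
  have hcν := continuousOn_normalized_gradient hU hφ hN
  obtain ⟨r₂, hr₂, hsub₂⟩ := Metric.mem_nhds_iff.1
    ((hcν.continuousAt (hU.mem_nhds hpU)).preimage_mem_nhds
      (Metric.ball_mem_nhds _ (show 0 < ε / 2 / ‖w‖ by positivity)))
  set r := min r₁ r₂ with hr
  set W := Metric.ball p r with hWdef
  have hW₁ : W ⊆ Metric.ball p r₁ := Metric.ball_subset_ball (min_le_left _ _)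
  have hW₂ : W ⊆ Metric.ball p r₂ := Metric.ball_subset_ball (min_le_right _ _)
  have hWU : W ⊆ U := hW₁.trans hsub₁
  rw [← hνp] at haff
  have haff' : ∀ q ∈ W, ∀ q' ∈ W, |φ q - φ q' - ‖gradient φ p‖ * ⟪ν p, q - q'⟫| ≤
      κ / ‖w‖ * ‖gradient φ p‖ * ‖q - q'‖ :=
    fun q hq q' hq' => haff q (hW₁ hq) q' (hW₁ hq')
  have hηw : (κ : ℝ) / ‖w‖ * ‖w‖ = κ := div_mul_cancel₀ _ hw0.ne'
  have hmono := lt_of_almost_affine ha haff' hw (by rw [hηw]; linarith)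
  set Z := {q | q ∈ W ∧ φ q = 0} with hZ
  have hZflat : ∀ q ∈ Z, ∀ q' ∈ Z, |⟪ν p, q - q'⟫| * ‖w‖ ≤ κ * ‖q - q'‖ := by
    intro q hq q' hq'
    have := abs_inner_le_of_almost_affine ha haff' hq.1 hq'.1 (hq.2.trans hq'.2.symm)
    calc |⟪ν p, q - q'⟫| * ‖w‖ ≤ κ / ‖w‖ * ‖q - q'‖ * ‖w‖ := by gcongr
      _ = κ / ‖w‖ * ‖w‖ * ‖q - q'‖ := by ring
      _ = _ := by rw [hηw]
  have hinj : InjOn (obliqueProj (ν p) w) Z := injOn_obliqueProj hw hmono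
  have hΓZ : Γ ∩ W = Z := by
    ext q
    constructor
    · rintro ⟨h1, h2⟩
      exact ⟨h2, ((hΓ ▸ (⟨h1, hWU h2⟩ : q ∈ Γ ∩ U) : q ∈ {x | x ∈ U ∧ φ x = 0})).2⟩
    · rintro ⟨h1, h2⟩
      exact ⟨((hΓ ▸ (⟨hWU h1, h2⟩ : q ∈ {x | x ∈ U ∧ φ x = 0}) : q ∈ Γ ∩ U)).1, h1⟩
  have hΩW : Ω ∩ W = {q | q ∈ W ∧ φ q < 0} := by
    ext q
    constructor
    · rintro ⟨h1, h2⟩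
      exact ⟨h2, ((hΩ ▸ (⟨h1, hWU h2⟩ : q ∈ Ω ∩ U) : q ∈ {x | x ∈ U ∧ φ x < 0})).2⟩
    · rintro ⟨h1, h2⟩
      exact ⟨((hΩ ▸ (⟨hWU h1, h2⟩ : q ∈ {x | x ∈ U ∧ φ x < 0}) : q ∈ Ω ∩ U)).1, h1⟩
  have hWo : IsOpen W := Metric.isOpen_ball
  have hZm : MeasurableSet Z := hΓZ ▸ hΓm.inter hWo.measurableSet
  have hκ2 : κ ≤ 1 / 2 := hκ4.trans (by
    rw [← NNReal.coe_le_coe]; push_cast; norm_num)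
  have hZfin : μHE[d] Z < ∞ := euclideanHausdorffMeasure_lt_top_of_obliqueProj hn0 hw hκ2
    (Metric.isBounded_ball.subset fun q hq => hq.1) hZflat hinj
  have hPZm := measurableSet_image_of_injOn hZm (obliqueProj (ν p) w).continuous hinj
  refine ⟨W, hWo, Metric.mem_ball_self (lt_min hr₁ hr₂), fun f hf hfc hfW => ?_⟩
  have : IsFiniteMeasure (μHE[d].restrict Z) := ⟨by simpa using hZfin⟩
  have hfZ : IntegrableOn f Z μHE[d] := by
    obtain ⟨C, hC⟩ := hf.continuous.bounded_above_of_compact_support hfc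
    exact Integrable.of_bound hf.continuous.aestronglyMeasurable C (ae_of_all _ hC)
  have hZU : Z ⊆ Γ ∩ U := fun q hq =>
    ⟨((hΓZ ▸ hq : q ∈ Γ ∩ W)).1, hWU hq.1⟩
  have hνZ : ContinuousOn ν Z :=
    (hcν.mono fun q hq => hWU hq.1).congr fun q hq => hν q (hZU hq)
  have hνclose : ∀ q ∈ Z, |1 - ⟪w, ν q⟫| ≤ ε / 2 := by
    intro q hq
    have h1 := hsub₂ (hW₂ hq.1)
    rw [mem_preimage, Metric.mem_ball, dist_eq_norm, ← hν q (hZU hq), ← hνp] at h1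
    have h2 : 1 - ⟪w, ν q⟫ = ⟪w, ν p - ν q⟫ := by
      rw [inner_sub_right, real_inner_comm (ν p) w, hw]
    rw [h2]
    calc |⟪w, ν p - ν q⟫| ≤ ‖w‖ * ‖ν p - ν q‖ := abs_real_inner_le_norm _ _
      _ ≤ ‖w‖ * (ε / 2 / ‖w‖) := by
          rw [norm_sub_rev]; gcongr
      _ = ε / 2 := by field_simp
  have hzero : ∀ q ∉ W, f q = 0 := fun q hq =>
    image_eq_zero_of_notMem_tsupport fun h => hq (hfW h)
  have hgZ : IntegrableOn (fun q => f q * ⟪w, ν q⟫) Z μHE[d] := by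
    refine Integrable.mono' (hfZ.norm.const_mul (1 + ε / 2)) ?_ ?_
    · exact (hf.continuous.continuousOn.mul
        (continuousOn_const.inner hνZ)).aestronglyMeasurable hZm
    · refine (ae_restrict_iff' hZm).2 (ae_of_all _ fun q hq => ?_)
      rw [norm_mul, mul_comm]
      gcongr
      have := abs_le.1 (hνclose q hq)
      rw [Real.norm_eq_abs, abs_le]
      constructor <;> linarith [this.1, this.2]
  have hres : ∀ g : E → ℝ, (∀ q ∉ W, g q = 0) →
      ∫ q in Γ, g q ∂μHE[d] = ∫ q in Z, g q ∂μHE[d] := by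
    intro g hg
    rw [← hΓZ]
    exact setIntegral_eq_of_subset_of_forall_sdiff_eq_zero hΓm inter_subset_left
      fun q hq => hg q fun h => hq.2 ⟨hq.1, h⟩
  constructor
  · rw [← hΓZ] at hgZ
    exact hgZ.of_forall_sdiff_eq_zero hΓm fun q hq => by
      rw [hzero q fun h => hq.2 ⟨hq.1, h⟩, zero_mul]
  rw [hres _ fun q hq => by rw [hzero q hq, zero_mul],
    hres _ fun q hq => by rw [hzero q hq, abs_zero]]
  have hΩint : ∫ q in Ω, fderiv ℝ f q w = ∫ q in {q | q ∈ W ∧ φ q < 0}, fderiv ℝ f q w := by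
    rw [← hΩW]
    refine setIntegral_eq_of_subset_of_forall_sdiff_eq_zero hΩm inter_subset_left fun q hq => ?_
    have : q ∉ tsupport f := fun h => hq.2 ⟨hq.1, hfW h⟩
    rw [image_eq_zero_of_notMem_tsupport fun h => this (tsupport_fderiv_subset ℝ h)]
    rfl
  -- The volume integral becomes an integral of `f` over the projected surface; it remains to lift
  -- it to the surface and to insert the factor `⟪w, ν q⟫`.
  rw [hΩint, setIntegral_fderiv_eq_setIntegral_obliqueProj hn hw hWo (convex_ball _ _)
    (hφ.continuousOn.mono hWU) hmono hf hfc hfW hPZm]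
  have hfr : Module.finrank ℝ (ℝ ∙ ν p)ᗮ = d := by
    have := (ℝ ∙ ν p).finrank_add_finrank_orthogonal
    rw [finrank_span_singleton hn0] at this
    omega
  have hcmp := abs_setIntegral_image_sub_setIntegral_le (K := 1 + 2 * κ) (by simp) hPZm
    (fun q hq => hinj.leftInvOn_invFunOn hq) (lipschitzOnWith_obliqueProj hw hZflat)
    (lipschitzOnWith_invFunOn_obliqueProj hw hκ2 hZflat) d hf.continuous hfZ
  rw [show (μHE[d] : Measure (ℝ ∙ ν p)ᗮ) = volume by
    rw [← hfr]; exact InnerProductSpace.euclideanHausdorffMeasure_eq_volume] at hcmp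
  have hdiff : |∫ q in Z, f q ∂μHE[d] - ∫ q in Z, f q * ⟪w, ν q⟫ ∂μHE[d]| ≤
      ε / 2 * ∫ q in Z, |f q| ∂μHE[d] := by
    rw [← integral_sub hfZ hgZ, ← integral_const_mul]
    refine (abs_integral_le_integral_abs).trans
      (setIntegral_mono_on (hfZ.sub hgZ).abs (hfZ.abs.const_mul _) hZm fun q hq => ?_)
    rw [show f q - f q * ⟪w, ν q⟫ = (1 - ⟪w, ν q⟫) * f q by ring, abs_mul]
    exact mul_le_mul_of_nonneg_right (hνclose q hq) (abs_nonneg _)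
  have hnn : 0 ≤ ∫ q in Z, |f q| ∂μHE[d] := integral_nonneg fun _ => abs_nonneg _
  have hcmp' : (((1 + 2 * κ : ℝ≥0) : ℝ) ^ d - 1) * ∫ q in Z, |f q| ∂μHE[d] ≤
      ε / 2 * ∫ q in Z, |f q| ∂μHE[d] := by
    push_cast
    gcongr
  calc _ ≤ _ := abs_sub_le _ (∫ q in Z, f q ∂μHE[d]) _
    _ ≤ ε / 2 * ∫ q in Z, |f q| ∂μHE[d] + ε / 2 * ∫ q in Z, |f q| ∂μHE[d] :=
        add_le_add (hcmp.trans hcmp') hdiff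
    _ = _ := by ring

end LocalGaussGreen

/-! ### Gauss-Green for all directions, and from local to global -/

section GaussGreen

variable {E : Type*} [NormedAddCommGroup E] [InnerProductSpace ℝ E] [FiniteDimensional ℝ E]
  [MeasurableSpace E] [BorelSpace E]

/-- Gauss-Green near `p` in direction `v`, up to a small relative error. -/
def GaussGreenApprox (Ω Γ : Set E) (ν : E → E) (v : E) (ε : ℝ) (W : Set E) : Prop :=
  ∀ f : E → ℝ, ContDiff ℝ 1 f → HasCompactSupport f → tsupport f ⊆ W →
    IntegrableOn (fun q => f q * ⟪v, ν q⟫) Γ μHE[Module.finrank ℝ E - 1] ∧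
    |(∫ q in Ω, fderiv ℝ f q v) -
        ∫ q in Γ, f q * ⟪v, ν q⟫ ∂μHE[Module.finrank ℝ E - 1]| ≤
      ε * ∫ q in Γ, |f q| ∂μHE[Module.finrank ℝ E - 1]

lemma ContDiff.integrable_fderiv_apply {f : E → ℝ} (hf : ContDiff ℝ 1 f)
    (hfc : HasCompactSupport f) (v : E) : Integrable fun q => fderiv ℝ f q v :=
  ((hf.continuous_fderiv one_ne_zero).clm_apply continuous_const).integrable_of_hasCompactSupport
    (hfc.fderiv_apply ℝ v)

lemma ContDiff.integral_fderiv_apply_eq_zero {f : E → ℝ} (hf : ContDiff ℝ 1 f)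
    (hfc : HasCompactSupport f) (v : E) : ∫ q, fderiv ℝ f q v = 0 := by
  have := integral_mul_fderiv_eq_neg_fderiv_mul_of_integrable (𝕜 := ℝ) (μ := (volume : Measure E))
    (f := fun _ => (1 : ℝ)) (g := f) (v := v) (by simp)
    (by simpa using hf.integrable_fderiv_apply hfc v)
    (by simpa using hf.continuous.integrable_of_hasCompactSupport hfc)
    (fun _ _ => differentiableAt_const _) (fun _ _ => hf.differentiable one_ne_zero _)
  simpa using this

/-- Gauss-Green near a boundary point, for an arbitrary direction and up to a small relative
error. -/
lemma exists_gaussGreenApprox_of_mem_surface {Ω Γ U : Set E} {ν : E → E} {φ : E → ℝ} {p : E}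
    (hΓm : MeasurableSet Γ) (hU : IsOpen U) (hp : p ∈ Γ) (hpU : p ∈ U) (hφ : ContDiffOn ℝ 1 φ U)
    (hN : ∀ x ∈ U, gradient φ x ≠ 0) (hΓ : Γ ∩ U = {x | x ∈ U ∧ φ x = 0})
    (hΩ : Ω ∩ U = {x | x ∈ U ∧ φ x < 0}) (hΩm : MeasurableSet Ω)
    (hν : ∀ x ∈ Γ ∩ U, ν x = ‖gradient φ x‖⁻¹ • gradient φ x)
    (v : E) {ε : ℝ} (hε : 0 < ε) :
    ∃ W, IsOpen W ∧ p ∈ W ∧ GaussGreenApprox Ω Γ ν v ε W := by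
  have hn : ⟪ν p, ν p⟫ = 1 := by
    have ha : ‖gradient φ p‖ ≠ 0 := norm_ne_zero_iff.2 (hN p hpU)
    rw [real_inner_self_eq_norm_sq, hν p ⟨hp, hpU⟩, norm_smul, norm_inv, norm_norm,
      inv_mul_cancel₀ ha, one_pow]
  -- Both sides are linear in the direction, and `v = (v - c ν(p)) + c ν(p)`, where `v - c ν(p)` and
  -- `ν(p)` both have normal component `1` at `p`.
  set c := ⟪ν p, v⟫ - 1 with hc
  have hw : ⟪ν p, v - c • ν p⟫ = 1 := by
    rw [inner_sub_right, inner_smul_right, hn]; simp [hc]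
  have hc0 : 0 < |c| + 1 := by positivity
  obtain ⟨W₁, hW₁, hp₁, h₁⟩ := exists_nhds_abs_gaussGreen_le_of_transversal hΓm hU hp hpU hφ hN hΓ hΩ
    hΩm hν hw (half_pos hε)
  obtain ⟨W₂, hW₂, hp₂, h₂⟩ := exists_nhds_abs_gaussGreen_le_of_transversal hΓm hU hp hpU hφ hN hΓ hΩ
    hΩm hν hn (show 0 < ε / 2 / (|c| + 1) by positivity)
  refine ⟨W₁ ∩ W₂, hW₁.inter hW₂, ⟨hp₁, hp₂⟩, fun f hf hfc hfW => ?_⟩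
  obtain ⟨i₁, e₁⟩ := h₁ f hf hfc (hfW.trans inter_subset_left)
  obtain ⟨i₂, e₂⟩ := h₂ f hf hfc (hfW.trans inter_subset_right)
  have hpt : ∀ q, f q * ⟪v, ν q⟫ = f q * ⟪v - c • ν p, ν q⟫ + c * (f q * ⟪ν p, ν q⟫) := by
    intro q
    rw [inner_sub_left, real_inner_smul_left]; ring
  have hpt' : ∀ q, fderiv ℝ f q v = fderiv ℝ f q (v - c • ν p) + c * fderiv ℝ f q (ν p) := by
    intro q
    rw [map_sub, map_smul, smul_eq_mul]; ring
  simp_rw [hpt, hpt']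
  refine ⟨i₁.add (i₂.const_mul c), ?_⟩
  rw [integral_add i₁ (i₂.const_mul c), integral_add
    (hf.integrable_fderiv_apply hfc _).integrableOn
    ((hf.integrable_fderiv_apply hfc _).integrableOn.const_mul c),
    integral_const_mul, integral_const_mul, add_sub_add_comm, ← mul_sub]
  have hnn : 0 ≤ ∫ q in Γ, |f q| ∂μHE[Module.finrank ℝ E - 1] :=
    integral_nonneg fun _ => abs_nonneg _
  refine (abs_add_le _ _).trans ?_
  rw [abs_mul]
  have h3 := mul_le_mul_of_nonneg_left e₂ (abs_nonneg c)
  have h4 : |c| * (ε / 2 / (|c| + 1)) ≤ ε / 2 := by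
    rw [mul_div_assoc', div_le_iff₀ hc0]
    nlinarith [abs_nonneg c]
  nlinarith [mul_le_mul_of_nonneg_right h4 hnn]

/-- For interior points: `f` vanishes on `Γ`, and the integral of a derivative of a compactly
supported function over the whole space is zero, so there is no error at all. -/
lemma gaussGreenApprox_of_subset {Ω Γ W : Set E} (ν : E → E) (v : E) {ε : ℝ} (hε : 0 < ε)
    (hW : W ⊆ Ω) (hΓ : Disjoint Γ Ω) (hΓm : MeasurableSet Γ) : GaussGreenApprox Ω Γ ν v ε W := by
  intro f hf hfc hfW
  have h0 : ∀ q ∈ Γ, f q = 0 := fun q hq =>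
    image_eq_zero_of_notMem_tsupport fun h => hΓ.le_bot ⟨hq, hW (hfW h)⟩
  have h1 : EqOn (fun q => f q * ⟪v, ν q⟫) (fun _ => 0) Γ := fun q hq => by simp [h0 q hq]
  refine ⟨(integrableOn_congr_fun h1 hΓm).2 integrableOn_zero, ?_⟩
  rw [setIntegral_congr_fun hΓm h1, setIntegral_eq_integral_of_forall_compl_eq_zero,
    hf.integral_fderiv_apply_eq_zero hfc]
  · simp only [integral_zero, sub_zero, abs_zero]
    positivity
  · intro q hq
    rw [image_eq_zero_of_notMem_tsupport fun h =>
      hq (hW (hfW (tsupport_fderiv_subset ℝ h)))]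
    rfl

/-- The Gauss-Green formula from its local approximate versions. -/
lemma setIntegral_fderiv_eq_of_gaussGreenApprox {Ω Γ : Set E} {ν : E → E} {v : E}
    (hΩ : IsOpen Ω) (hΩb : Bornology.IsBounded Ω) (hΓm : MeasurableSet Γ) (hΓΩ : Γ ⊆ closure Ω)
    (hΓfin : μHE[Module.finrank ℝ E - 1] Γ < ∞) {u : E → ℝ} (hu : ContDiff ℝ 1 u)
    (hloc : ∀ p ∈ closure Ω ∩ tsupport u, ∀ ε > 0,
      ∃ W, IsOpen W ∧ p ∈ W ∧ GaussGreenApprox Ω Γ ν v ε W) :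
    ∫ q in Ω, fderiv ℝ u q v =
      ∫ q in Γ, u q * ⟪v, ν q⟫ ∂μHE[Module.finrank ℝ E - 1] := by
  set d := Module.finrank ℝ E - 1
  have hK : IsCompact (closure Ω) := hΩb.isCompact_closure
  have : IsFiniteMeasure (μHE[d].restrict Γ) := ⟨by simpa using hΓfin⟩
  have hcΓ : ∀ g : E → ℝ, Continuous g → IntegrableOn g Γ μHE[d] := by
    intro g hg
    obtain ⟨C, hC⟩ := hK.exists_bound_of_continuousOn hg.continuousOn
    exact Integrable.of_bound hg.aestronglyMeasurable C
      ((ae_restrict_iff' hΓm).2 (ae_of_all _ fun q hq => hC q (hΓΩ hq)))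
  -- The partition functions are nonnegative with sum `1` on the support of `u` in `closure Ω`, so
  -- the local errors `ε ∫ |ρᵢ u|` add up to `ε ∫ |u|`, whatever the number of pieces.
  have key : ∀ ε > 0, |(∫ q in Ω, fderiv ℝ u q v) -
      ∫ q in Γ, u q * ⟪v, ν q⟫ ∂μHE[d]| ≤ ε * ∫ q in Γ, |u q| ∂μHE[d] := by
    intro ε hε
    set s := closure Ω ∩ tsupport u
    choose! W hWo hpW hW using fun p hp => hloc p hp ε hε
    -- The unit balls make each `ρᵢ u` compactly supported; `u` itself need not be.
    obtain ⟨ρ, hρ⟩ := SmoothPartitionOfUnity.exists_isSubordinate (modelWithCornersSelf ℝ E)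
      (s := s) (isClosed_closure.inter (isClosed_tsupport u))
      (fun p : s => W p ∩ Metric.ball (p : E) 1)
      (fun p => (hWo p p.2).inter Metric.isOpen_ball)
      (fun p hp => mem_iUnion.2 ⟨⟨p, hp⟩, hpW p hp, Metric.mem_ball_self one_pos⟩)
    have hfin := ρ.locallyFinite.finite_nonempty_inter_compact hK
    set t := hfin.toFinset with ht
    have hsum : ∀ q ∈ closure Ω, u q = ∑ i ∈ t, ρ i q * u q := by
      intro q hq
      by_cases hqu : q ∈ tsupport u
      · rw [← Finset.sum_mul]
        have h1 := ρ.sum_eq_one (x := q) ⟨hq, hqu⟩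
        rw [finsum_eq_sum_of_support_subset (s := t)] at h1
        · rw [h1, one_mul]
        · intro i hi
          simp only [ht, Finite.coe_toFinset]
          exact ⟨q, hi, hq⟩
      · simp [image_eq_zero_of_notMem_tsupport hqu]
    have hρd : ∀ i, ContDiff ℝ 1 (ρ i) := fun i =>
      (ρ i).contMDiff.contDiff.of_le (by exact_mod_cast le_top)
    have hfd : ∀ i, ContDiff ℝ 1 fun q => ρ i q * u q := fun i => (hρd i).mul hu
    have hts : ∀ i, tsupport (fun q => ρ i q * u q) ⊆ tsupport (ρ i) := fun i =>
      closure_mono fun q hq => left_ne_zero_of_mul hq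
    have hcs : ∀ i, HasCompactSupport fun q => ρ i q * u q := fun i =>
      Metric.isCompact_of_isClosed_isBounded (isClosed_tsupport _)
        (Metric.isBounded_ball.subset ((hts i).trans ((hρ i).trans inter_subset_right)))
    have happ : ∀ i, _ := fun i : s => hW i i.2 (fun q => ρ i q * u q) (hfd i) (hcs i)
      ((hts i).trans ((hρ i).trans inter_subset_left))
    have e₁ : ∫ q in Ω, fderiv ℝ u q v =
        ∑ i ∈ t, ∫ q in Ω, fderiv ℝ (fun q => ρ i q * u q) q v := by
      rw [← integral_finsetSum _ fun i _ =>
        ((hfd i).integrable_fderiv_apply (hcs i) v).integrableOn]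
      refine setIntegral_congr_fun hΩ.measurableSet fun q hq => ?_
      have hev : u =ᶠ[𝓝 q] fun q => ∑ i ∈ t, ρ i q * u q :=
        Filter.eventuallyEq_of_mem (hΩ.mem_nhds hq) fun q hq => hsum q (subset_closure hq)
      change fderiv ℝ u q v = _
      rw [hev.fderiv_eq, fderiv_fun_sum fun i _ => (hfd i).differentiable one_ne_zero q]
      simp
    have e₂ : ∫ q in Γ, u q * ⟪v, ν q⟫ ∂μHE[d] =
        ∑ i ∈ t, ∫ q in Γ, ρ i q * u q * ⟪v, ν q⟫ ∂μHE[d] := by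
      rw [← integral_finsetSum _ fun i _ => (happ i).1]
      refine setIntegral_congr_fun hΓm fun q hq => ?_
      rw [← Finset.sum_mul, ← hsum q (hΓΩ hq)]
    have e₃ : ∫ q in Γ, |u q| ∂μHE[d] = ∑ i ∈ t, ∫ q in Γ, |ρ i q * u q| ∂μHE[d] := by
      rw [← integral_finsetSum _ fun i _ => hcΓ _ (hfd i).continuous.abs]
      refine setIntegral_congr_fun hΓm fun q hq => ?_
      conv_lhs => rw [hsum q (hΓΩ hq), ← Finset.sum_mul, abs_mul,
        abs_of_nonneg (Finset.sum_nonneg fun i _ => ρ.nonneg i q), Finset.sum_mul]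
      exact Finset.sum_congr rfl fun i _ => by rw [abs_mul, abs_of_nonneg (ρ.nonneg i q)]
    rw [e₁, e₂, e₃, ← Finset.sum_sub_distrib, Finset.mul_sum]
    exact (Finset.abs_sum_le_sum_abs _ _).trans (Finset.sum_le_sum fun i _ => (happ i).2)
  have hnn : 0 ≤ ∫ q in Γ, |u q| ∂μHE[d] := integral_nonneg fun _ => abs_nonneg _
  refine eq_of_abs_sub_nonpos (le_of_forall_pos_le_add fun δ hδ => ?_)
  refine (key (δ / (∫ q in Γ, |u q| ∂μHE[d] + 1)) (by positivity)).trans ?_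
  rw [zero_add, div_mul_eq_mul_div, div_le_iff₀ (by positivity)]
  nlinarith

end GaussGreen

/-! ### Topology, finite area and Gauss-Green for a Lyapunov domain -/

namespace IsLyapunovDomain

variable {m : ℕ} [NeZero m] {Ω Γ₁ Γ : Set (EuclideanSpace ℝ (Fin m))}
  {n : EuclideanSpace ℝ (Fin m) → EuclideanSpace ℝ (Fin m)}

lemma zero_of_mem_flat (h : IsLyapunovDomain Ω Γ₁ Γ n) : ∀ x ∈ Γ₁, x 0 = 0 := by
  obtain ⟨V, -, rfl⟩ := h.flat_open
  exact fun x hx => hx.2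

lemma zero_of_mem_edge (h : IsLyapunovDomain Ω Γ₁ Γ n) : ∀ x ∈ edge Γ₁, x 0 = 0 := by
  intro x hx
  have hcl : IsClosed {x : EuclideanSpace ℝ (Fin m) | x 0 = 0} :=
    isClosed_eq (by fun_prop) continuous_const
  exact closure_minimal (fun y hy => h.zero_of_mem_flat y hy) hcl hx.1

lemma isOpen_halfSpace : IsOpen {x : EuclideanSpace ℝ (Fin m) | 0 < x 0} :=
  isOpen_lt continuous_const (by fun_prop)

lemma surface_eq (h : IsLyapunovDomain Ω Γ₁ Γ n) : Γ = closure Γ ∩ {x | 0 < x 0} := by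
  ext x
  constructor
  · exact fun hx => ⟨subset_closure hx, h.pos_of_mem_surface x hx⟩
  · rintro ⟨hx, hx0⟩
    rw [h.closure_surface] at hx
    refine hx.resolve_right fun hxe => ?_
    exact (ne_of_gt hx0) (h.zero_of_mem_edge x hxe)

lemma measurableSet_surface (h : IsLyapunovDomain Ω Γ₁ Γ n) : MeasurableSet Γ := by
  rw [h.surface_eq]
  exact isClosed_closure.measurableSet.inter isOpen_halfSpace.measurableSet

lemma surface_subset_frontier (h : IsLyapunovDomain Ω Γ₁ Γ n) : Γ ⊆ frontier Ω := by
  rw [h.frontier_eq]; exact subset_union_right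

lemma surface_subset_closure (h : IsLyapunovDomain Ω Γ₁ Γ n) : Γ ⊆ closure Ω :=
  h.surface_subset_frontier.trans frontier_subset_closure

lemma disjoint_surface (h : IsLyapunovDomain Ω Γ₁ Γ n) : Disjoint Γ Ω := by
  have := h.isOpen.inter_frontier_eq
  rw [disjoint_iff_inter_eq_empty, inter_comm]
  exact subset_empty_iff.1 (this ▸ inter_subset_inter_right _ h.surface_subset_frontier)

lemma mem_or_mem_of_pos (h : IsLyapunovDomain Ω Γ₁ Γ n) {x : EuclideanSpace ℝ (Fin m)}
    (hx : x ∈ closure Ω) (hx0 : 0 < x 0) : x ∈ Ω ∨ x ∈ Γ := by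
  by_cases hxΩ : x ∈ Ω
  · exact Or.inl hxΩ
  have hf : x ∈ frontier Ω := by rw [h.isOpen.frontier_eq]; exact ⟨hx, hxΩ⟩
  rw [h.frontier_eq] at hf
  rcases hf with (h1 | h1) | h1
  · exact absurd (h.zero_of_mem_flat x h1) hx0.ne'
  · exact absurd (h.zero_of_mem_edge x h1) hx0.ne'
  · exact Or.inr h1

lemma isCompact_closure_surface (h : IsLyapunovDomain Ω Γ₁ Γ n) : IsCompact (closure Γ) :=
  h.isBounded.isCompact_closure.of_isClosed_subset isClosed_closure
    (closure_minimal h.surface_subset_closure isClosed_closure)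

/-- An almost flat piece of the surface near one of its points. -/
lemma exists_flat_ball (h : IsLyapunovDomain Ω Γ₁ Γ n) {p : EuclideanSpace ℝ (Fin m)}
    (hp : p ∈ Γ ∪ edge Γ₁) {η : ℝ} (hη : 0 < η) :
    ‖n p‖ = 1 ∧ ∃ (r : ℝ) (φ : EuclideanSpace ℝ (Fin m) → ℝ) (a : ℝ), 0 < r ∧ 0 < a ∧
      gradient φ p = a • n p ∧
      ContDiffOn ℝ 1 φ (Metric.ball p r) ∧ (∀ x ∈ Metric.ball p r, gradient φ x ≠ 0) ∧
      (∀ q ∈ Metric.ball p r, ∀ q' ∈ Metric.ball p r,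
        |φ q - φ q' - a * ⟪n p, q - q'⟫| ≤ η * a * ‖q - q'‖) ∧
      (∀ x ∈ Metric.ball p r, x ∈ Γ ∪ edge Γ₁ ↔ 0 ≤ x 0 ∧ φ x = 0) ∧
      (∀ x ∈ Metric.ball p r, x ∈ Ω ↔ 0 < x 0 ∧ φ x < 0) ∧
      ∀ x ∈ (Γ ∪ edge Γ₁) ∩ Metric.ball p r, n x = ‖gradient φ x‖⁻¹ • gradient φ x := by
  obtain ⟨U, φ, hU, hpU, hφ, hN, hΓ, hΩ, hn⟩ := h.normal p hp
  obtain ⟨r, hr, hrU, haff⟩ := exists_ball_abs_sub_inner_le hU hpU hφ (hN p hpU) hη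
  have ha : 0 < ‖gradient φ p‖ := norm_pos_iff.2 (hN p hpU)
  have hnp := hn p ⟨hp, hpU⟩
  rw [← hnp] at haff
  refine ⟨?_, r, φ, ‖gradient φ p‖, hr, ha, ?_, hφ.mono hrU, fun x hx => hN x (hrU hx), haff,
    fun x hx => ?_, fun x hx => ?_, fun x hx => hn x ⟨hx.1, hrU hx.2⟩⟩
  · rw [hnp, norm_smul, norm_inv, norm_norm, inv_mul_cancel₀ ha.ne']
  · rw [hnp, smul_smul, mul_inv_cancel₀ ha.ne', one_smul]
  · have := Set.ext_iff.1 hΓ x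
    simp only [mem_inter_iff, mem_ofPred_eq, hrU hx, and_true, true_and] at this
    exact this
  · have := Set.ext_iff.1 hΩ x
    simp only [mem_inter_iff, mem_ofPred_eq, hrU hx, and_true, true_and] at this
    exact this

/-- The closure of `Γ` is compact, and charts exist at the edge points too, so finitely many nearly
flat pieces cover it. -/
lemma measure_surface_lt_top (h : IsLyapunovDomain Ω Γ₁ Γ n) : μHE[m - 1] Γ < ∞ := by
  refine (measure_mono subset_closure).trans_lt
    (h.isCompact_closure_surface.measure_lt_top_of_nhdsWithin fun p hp => ?_)
  rw [h.closure_surface] at hp ⊢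
  obtain ⟨hn, r, φ, a, hr, ha, -, hφ, hN, haff, hΓ, -⟩ :=
    h.exists_flat_ball hp (show (0 : ℝ) < 1 / 4 by norm_num)
  refine ⟨(Γ ∪ edge Γ₁) ∩ Metric.ball p r,
    inter_mem_nhdsWithin _ (Metric.ball_mem_nhds p hr), ?_⟩
  have hnn : ⟪n p, n p⟫ = 1 := by rw [real_inner_self_eq_norm_sq, hn, one_pow]
  have hsub : (Γ ∪ edge Γ₁) ∩ Metric.ball p r ⊆ {q | q ∈ Metric.ball p r ∧ φ q = 0} :=
    fun q hq => ⟨hq.2, ((hΓ q hq.2).1 hq.1).2⟩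
  refine (measure_mono hsub).trans_lt ?_
  have := euclideanHausdorffMeasure_lt_top_of_obliqueProj (κ := 1 / 4)
    (norm_ne_zero_iff.1 (by rw [hn]; exact one_ne_zero)) hnn
    (by rw [← NNReal.coe_le_coe]; push_cast; norm_num)
    (Metric.isBounded_ball.subset fun q hq => hq.1)
    (fun q hq q' hq' => by
      rw [hn, mul_one]
      simpa using abs_inner_le_of_almost_affine ha haff hq.1 hq'.1 (hq.2.trans hq'.2.symm))
    (injOn_obliqueProj hnn
      (lt_of_almost_affine ha haff hnn (by rw [hn]; norm_num)))
  simpa using this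

/-- The Gauss-Green formula for functions supported in the open half-space. -/
lemma setIntegral_fderiv_eq (h : IsLyapunovDomain Ω Γ₁ Γ n) {u : EuclideanSpace ℝ (Fin m) → ℝ}
    (hu : ContDiff ℝ 1 u) (hupos : tsupport u ⊆ {x | 0 < x 0}) (v : EuclideanSpace ℝ (Fin m)) :
    ∫ q in Ω, fderiv ℝ u q v = ∫ q in Γ, u q * ⟪v, n q⟫ ∂μHE[m - 1] := by
  have := setIntegral_fderiv_eq_of_gaussGreenApprox (ν := n) (v := v) h.isOpen h.isBounded
    h.measurableSet_surface h.surface_subset_closure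
    (by simpa using h.measure_surface_lt_top) hu ?_
  · simpa using this
  rintro p ⟨hp, hpu⟩ ε hε
  rcases h.mem_or_mem_of_pos hp (hupos hpu) with hpΩ | hpΓ
  · exact ⟨Ω, h.isOpen, hpΩ, gaussGreenApprox_of_subset n v hε le_rfl h.disjoint_surface
      h.measurableSet_surface⟩
  · obtain ⟨-, r, φ, a, hr, ha, -, hφ, hN, haff, hΓ, hΩ, hn⟩ :=
      h.exists_flat_ball (Or.inl hpΓ) one_pos
    have hUsub : Metric.ball p r ∩ {x | 0 < x 0} ⊆ Metric.ball p r := inter_subset_left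
    -- Inside the open half-space the sign conditions on `x₁` in the chart hold automatically, and
    -- the edge is absent.
    refine exists_gaussGreenApprox_of_mem_surface (U := Metric.ball p r ∩ {x | 0 < x 0}) (φ := φ)
      h.measurableSet_surface (Metric.isOpen_ball.inter isOpen_halfSpace) hpΓ
      ⟨Metric.mem_ball_self hr, h.pos_of_mem_surface p hpΓ⟩ (hφ.mono hUsub)
      (fun x hx => hN x hx.1) ?_ ?_ h.isOpen.measurableSet
      (fun x hx => hn x ⟨Or.inl hx.1, hx.2.1⟩) v hε
    · ext x
      constructor
      · rintro ⟨h1, h2⟩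
        exact ⟨h2, ((hΓ x h2.1).1 (Or.inl h1)).2⟩
      · rintro ⟨h1, h2⟩
        refine ⟨?_, h1⟩
        refine ((hΓ x h1.1).2 ⟨le_of_lt h1.2, h2⟩).resolve_right fun he => ?_
        exact (ne_of_gt h1.2) (h.zero_of_mem_edge x he)
    · ext x
      constructor
      · rintro ⟨h1, h2⟩
        exact ⟨h2, ((hΩ x h2.1).1 h1).2⟩
      · rintro ⟨h1, h2⟩
        exact ⟨(hΩ x h1.1).2 ⟨h1.2, h2⟩, h1⟩

end IsLyapunovDomain

/-! ### Chords of a surface with Hölder continuous normal -/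

section Lyapunov

variable {E : Type*} [NormedAddCommGroup E] [InnerProductSpace ℝ E]

/-- A mean value inequality for `s ↦ ⟪b, c s - c 0⟫`. In an increment of `c`, the part `b - N s` of
`b` contributes at most `D L` per unit of `s`, and the part `N s` contributes nothing to first
order. Only right-hand slopes enter, so `c` need not be differentiable. -/
lemma inner_sub_le_of_curve {c N : ℝ → E} {b : E} {L D : ℝ} (hL : 0 ≤ L)
    (hc : ∀ s ∈ Icc (0 : ℝ) 1, ∀ s' ∈ Icc (0 : ℝ) 1, ‖c s - c s'‖ ≤ L * |s - s'|)
    (htan : ∀ s ∈ Ico (0 : ℝ) 1, ∀ ε > 0, ∀ᶠ z in 𝓝[>] s, |⟪N s, c z - c s⟫| ≤ ε * ‖c z - c s‖)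
    (hN : ∀ s ∈ Ico (0 : ℝ) 1, ‖b - N s‖ ≤ D) : ⟪b, c 1 - c 0⟫ ≤ L * D := by
  have hcont : ContinuousOn c (Icc 0 1) := by
    refine (LipschitzOnWith.of_dist_le_mul (K := L.toNNReal) fun s hs s' hs' => ?_).continuousOn
    rw [dist_eq_norm, Real.dist_eq, Real.coe_toNNReal _ hL]
    exact hc s hs s' hs'
  have key := image_le_of_liminf_slope_right_le_deriv_boundary
    (f := fun s => ⟪b, c s - c 0⟫) (a := 0) (b := 1) (B := fun s => L * D * s)
    (B' := fun _ => L * D) (by fun_prop) (by simp) (by fun_prop)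
    (fun s _ => by simpa using ((hasDerivWithinAt_id s (Ici s)).const_mul (L * D))) ?_
    (right_mem_Icc.2 zero_le_one)
  · simpa using key
  intro s hs R hR
  have hε : 0 < (R - L * D) / (2 * (L + 1)) := by
    have : 0 < R - L * D := sub_pos.2 hR
    positivity
  have hz : ∀ᶠ z in 𝓝[>] s, z ∈ Ioo s 1 := Ioo_mem_nhdsGT hs.2
  refine ((htan s hs _ hε).and hz).frequently.mono fun z hz => ?_
  obtain ⟨h1, hz1, hz2⟩ := hz
  have hzs : 0 < z - s := sub_pos.2 hz1
  rw [slope_def_field, div_lt_iff₀ hzs]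
  have hcz := hc z ⟨hs.1.trans hz1.le, hz2.le⟩ s ⟨hs.1, hs.2.le⟩
  rw [abs_of_pos hzs] at hcz
  have h2 : ⟪b, c z - c 0⟫ - ⟪b, c s - c 0⟫ = ⟪b - N s, c z - c s⟫ + ⟪N s, c z - c s⟫ := by
    rw [← inner_sub_right, ← inner_add_left, sub_add_cancel, sub_sub_sub_cancel_right]
  have hD : 0 ≤ D := (norm_nonneg _).trans (hN s hs)
  have h3 : ⟪b - N s, c z - c s⟫ ≤ D * (L * (z - s)) :=
    (real_inner_le_norm _ _).trans (mul_le_mul (hN s hs) hcz (norm_nonneg _) hD)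
  have h4 : ⟪N s, c z - c s⟫ ≤ (R - L * D) / (2 * (L + 1)) * (L * (z - s)) :=
    (le_abs_self _).trans (h1.trans (mul_le_mul_of_nonneg_left hcz hε.le))
  have h5 : (R - L * D) / (2 * (L + 1)) * L < R - L * D := by
    rw [div_mul_eq_mul_div, div_lt_iff₀ (by positivity)]
    nlinarith [sub_pos.2 hR]
  rw [h2]
  nlinarith [mul_lt_mul_of_pos_right h5 hzs]

lemma abs_inner_sub_le_of_curve {c N : ℝ → E} {b : E} {L D : ℝ} (hL : 0 ≤ L)
    (hc : ∀ s ∈ Icc (0 : ℝ) 1, ∀ s' ∈ Icc (0 : ℝ) 1, ‖c s - c s'‖ ≤ L * |s - s'|)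
    (htan : ∀ s ∈ Ico (0 : ℝ) 1, ∀ ε > 0, ∀ᶠ z in 𝓝[>] s, |⟪N s, c z - c s⟫| ≤ ε * ‖c z - c s‖)
    (hN : ∀ s ∈ Ico (0 : ℝ) 1, ‖b - N s‖ ≤ D) : |⟪b, c 1 - c 0⟫| ≤ L * D := by
  rw [abs_le']
  refine ⟨inner_sub_le_of_curve hL hc htan hN, ?_⟩
  rw [← inner_neg_left]
  refine inner_sub_le_of_curve (N := fun s => -N s) hL hc (fun s hs ε hε => ?_) fun s hs => ?_
  · simpa using htan s hs ε hε
  · rw [neg_sub_neg, norm_sub_rev]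
    exact hN s hs

/-- A chord of the unit sphere is shorter than its arc, by `cos θ ≥ 1 - θ²/2`. -/
lemma norm_sub_le_angle {u v : E} (hu : ‖u‖ = 1) (hv : ‖v‖ = 1) :
    ‖u - v‖ ≤ InnerProductGeometry.angle u v := by
  have h0 := InnerProductGeometry.cos_angle_mul_norm_mul_norm u v
  have h1 := norm_sub_sq_real u v
  rw [← h0, hu, hv] at h1
  have h2 := Real.one_sub_sq_div_two_le_cos (x := InnerProductGeometry.angle u v)
  refine le_of_sq_le_sq ?_ (InnerProductGeometry.angle_nonneg u v)
  nlinarith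

/-- A level set with an almost constant normal is a graph over the tangent segment from one of its
points to the projection of another one. -/
lemma exists_curve_of_almost_affine {φ : E → ℝ} {x ξ b : E} {a r : ℝ} (ha : 0 < a)
    (hb : ‖b‖ = 1) (hφc : ContinuousOn φ (Metric.ball x r))
    (haff : ∀ q ∈ Metric.ball x r, ∀ q' ∈ Metric.ball x r,
      |φ q - φ q' - a * ⟪b, q - q'⟫| ≤ 1 / 4 * a * ‖q - q'‖)
    (hx : φ x = 0) (hξ : φ ξ = 0) (hξr : ‖ξ - x‖ < r / 2) :
    ∃ c : ℝ → E, c 0 = ξ ∧ c 1 = x ∧ (∀ s ∈ Icc (0 : ℝ) 1, c s ∈ Metric.ball x r ∧ φ (c s) = 0) ∧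
      (∀ s, ∃ t : ℝ, c s = x + (1 - s) • (ξ - x) + t • b) ∧
      ∀ s ∈ Icc (0 : ℝ) 1, ∀ s' ∈ Icc (0 : ℝ) 1, ‖c s - c s'‖ ≤ 2 * ‖ξ - x‖ * |s - s'| := by
  set ρ := ‖ξ - x‖ with hρ
  have hρ0 : 0 ≤ ρ := norm_nonneg _
  have hr : 0 < r := by linarith
  set v := (ξ - x) - ⟪b, ξ - x⟫ • b with hv
  have hbb : ⟪b, b⟫ = 1 := by rw [real_inner_self_eq_norm_sq, hb, one_pow]
  have hbv : ⟪b, v⟫ = 0 := by rw [hv, inner_sub_right, inner_smul_right, hbb]; ring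
  have hvρ : ‖v‖ ≤ ρ := by
    have h1 : ‖ξ - x‖ ^ 2 = ‖v‖ ^ 2 + ⟪b, ξ - x⟫ ^ 2 := by
      have h2 : ξ - x = v + ⟪b, ξ - x⟫ • b := by rw [hv, sub_add_cancel]
      conv_lhs => rw [h2, norm_add_sq_real, inner_smul_right, real_inner_comm b v, hbv, norm_smul,
        hb]
      simp
    exact le_of_sq_le_sq (by nlinarith [sq_nonneg ⟪b, ξ - x⟫]) hρ0
  have hball : ∀ s ∈ Icc (0 : ℝ) 1, ∀ t ∈ Icc (-ρ) ρ,
      x + ((1 - s) • v + t • b) ∈ Metric.ball x r ∧ ‖(1 - s) • v + t • b‖ ≤ 2 * ρ := by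
    intro s hs t ht
    have h1 : ‖(1 - s) • v + t • b‖ ≤ 2 * ρ := by
      refine (norm_add_le _ _).trans ?_
      rw [norm_smul, norm_smul, hb, Real.norm_eq_abs, Real.norm_eq_abs, mul_one,
        abs_of_nonneg (sub_nonneg.2 hs.2)]
      have := abs_le.2 ht
      nlinarith [hs.1, hs.2, norm_nonneg v]
    refine ⟨?_, h1⟩
    rw [Metric.mem_ball, dist_eq_norm, add_sub_cancel_left]
    linarith
  -- On this normal segment `φ` differs from `a t` by at most `(1/4) a (2ρ) = aρ/2`, so it changes
  -- sign between `t = -ρ` and `t = ρ`.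
  have hex : ∀ s ∈ Icc (0 : ℝ) 1, ∃ t ∈ Icc (-ρ) ρ, φ (x + ((1 - s) • v + t • b)) = 0 := by
    intro s hs
    have hval : ∀ t ∈ Icc (-ρ) ρ, |φ (x + ((1 - s) • v + t • b)) - a * t| ≤ a * ρ / 2 := by
      intro t ht
      obtain ⟨h1, h2⟩ := hball s hs t ht
      have := haff _ h1 x (Metric.mem_ball_self hr)
      rw [hx, sub_zero, add_sub_cancel_left, inner_add_right, inner_smul_right, inner_smul_right,
        hbv, hbb, mul_zero, zero_add, mul_one] at this
      refine this.trans ?_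
      nlinarith
    have hcont : ContinuousOn (fun t : ℝ => φ (x + ((1 - s) • v + t • b))) (Icc (-ρ) ρ) :=
      hφc.comp (by fun_prop) fun t ht => (hball s hs t ht).1
    have hle : -ρ ≤ ρ := by linarith
    have e1 := abs_le.1 (hval (-ρ) (left_mem_Icc.2 hle))
    have e2 := abs_le.1 (hval ρ (right_mem_Icc.2 hle))
    have haρ : 0 ≤ a * ρ := by positivity
    exact intermediate_value_Icc hle hcont ⟨by nlinarith [e1.2], by nlinarith [e2.1]⟩
  choose! τ hτ hφτ using hex
  set c : ℝ → E := fun s => x + ((1 - s) • v + τ s • b) with hc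
  -- Flatness gives `|t| ≤ ‖q - q'‖ / 4`, which is absorbed on the left. The case `z = 0` is
  -- uniqueness on normal lines and identifies the endpoints of the curve.
  have hlip : ∀ q ∈ Metric.ball x r, ∀ q' ∈ Metric.ball x r, φ q = 0 → φ q' = 0 →
      ∀ (z : E) (t : ℝ), ⟪b, z⟫ = 0 → q - q' = z + t • b → ‖q - q'‖ ≤ 2 * ‖z‖ := by
    intro q hq q' hq' h0 h0' z t hz he
    have h1 := abs_inner_le_of_almost_affine ha haff hq hq' (h0.trans h0'.symm)
    have h2 : ⟪b, q - q'⟫ = t := by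
      rw [he, inner_add_right, inner_smul_right, hz, hbb]; ring
    have h3 : ‖q - q'‖ ≤ ‖z‖ + |t| := by
      rw [he]
      refine (norm_add_le _ _).trans ?_
      rw [norm_smul, hb, mul_one, Real.norm_eq_abs]
    rw [h2] at h1
    linarith [norm_nonneg (q - q'), norm_nonneg z]
  have hmem : ∀ s ∈ Icc (0 : ℝ) 1, c s ∈ Metric.ball x r ∧ φ (c s) = 0 := fun s hs =>
    ⟨(hball s hs _ (hτ s hs)).1, hφτ s hs⟩
  refine ⟨c, ?_, ?_, hmem, fun s => ?_, fun s hs s' hs' => ?_⟩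
  · have h0 : (0 : ℝ) ∈ Icc (0 : ℝ) 1 := left_mem_Icc.2 zero_le_one
    have hξb : ξ ∈ Metric.ball x r := by
      rw [Metric.mem_ball, dist_eq_norm]; linarith
    have := hlip _ (hmem 0 h0).1 ξ hξb (hmem 0 h0).2 hξ 0 (τ 0 - ⟪b, ξ - x⟫) (inner_zero_right _)
      (by simp only [hc, hv, one_smul, sub_smul, zero_smul, zero_add]; abel)
    rw [norm_zero, mul_zero] at this
    exact sub_eq_zero.1 (norm_le_zero_iff.1 this)
  · have h1 : (1 : ℝ) ∈ Icc (0 : ℝ) 1 := right_mem_Icc.2 zero_le_one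
    have := hlip _ (hmem 1 h1).1 x (Metric.mem_ball_self hr) (hmem 1 h1).2 hx 0 (τ 1)
      (inner_zero_right _) (by simp [hc])
    rw [norm_zero, mul_zero] at this
    exact sub_eq_zero.1 (norm_le_zero_iff.1 this)
  · refine ⟨τ s - (1 - s) * ⟪b, ξ - x⟫, ?_⟩
    simp only [hc, hv, smul_sub, sub_smul, smul_smul]
    abel
  · have := hlip _ (hmem s hs).1 _ (hmem s' hs').1 (hmem s hs).2 (hmem s' hs').2
      ((s' - s) • v) (τ s - τ s') (by rw [inner_smul_right, hbv, mul_zero])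
      (by simp only [hc, sub_smul]; abel)
    refine this.trans ?_
    rw [norm_smul, Real.norm_eq_abs, abs_sub_comm]
    nlinarith [abs_nonneg (s - s'), mul_le_mul_of_nonneg_left hvρ (abs_nonneg (s - s'))]

end Lyapunov

namespace IsLyapunovDomain

variable {m : ℕ} [NeZero m] {Ω Γ₁ Γ : Set (EuclideanSpace ℝ (Fin m))}
  {n : EuclideanSpace ℝ (Fin m) → EuclideanSpace ℝ (Fin m)}

lemma norm_normal (h : IsLyapunovDomain Ω Γ₁ Γ n) {p : EuclideanSpace ℝ (Fin m)}
    (hp : p ∈ Γ ∪ edge Γ₁) : ‖n p‖ = 1 :=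
  (h.exists_flat_ball hp one_pos).1

/-- The chord from a point of the edge is almost tangent to the surface. -/
lemma exists_abs_inner_le (h : IsLyapunovDomain Ω Γ₁ Γ n) {x : EuclideanSpace ℝ (Fin m)}
    (hx : x ∈ edge Γ₁) : ∃ r C lam : ℝ, 0 < r ∧ 0 < lam ∧ 0 ≤ C ∧ ∀ ξ ∈ Γ, ‖ξ - x‖ < r →
      |⟪ξ - x, n ξ⟫| ≤ C * ‖ξ - x‖ ^ (1 + lam) := by
  obtain ⟨A, lam, hA, hlam, hang⟩ := h.angle_le
  obtain ⟨hn, r, φ, a, hr, ha, -, hφ, hN, haff, hΓ, -, hnor⟩ :=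
    h.exists_flat_ball (Or.inr hx) (show (0 : ℝ) < 1 / 4 by norm_num)
  refine ⟨r / 2, 2 * (A * 2 ^ lam), lam, by positivity, hlam, by positivity, fun ξ hξ hξr => ?_⟩
  have hx0 := h.zero_of_mem_edge x hx
  have hn0 := h.right_angle x hx
  have hξ0 := h.pos_of_mem_surface ξ hξ
  have hξball : ξ ∈ Metric.ball x r := by rw [Metric.mem_ball, dist_eq_norm]; linarith
  obtain ⟨c, hc0, hc1, hcz, hcrep, hclip⟩ := exists_curve_of_almost_affine ha hn
    hφ.continuousOn haff ((hΓ x (Metric.mem_ball_self hr)).1 (Or.inr hx)).2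
    ((hΓ ξ hξball).1 (Or.inl hξ)).2 hξr
  have hρ : 0 < ‖ξ - x‖ := by
    refine norm_pos_iff.2 (sub_ne_zero.2 ?_)
    rintro rfl
    exact hξ0.ne' hx0
  -- The right angle enters here: since `x₁ = 0` and `n(x)₁ = 0`, the first coordinate of `c s` is
  -- `(1 - s) ξ₁ > 0`. The curve thus stays in `Γ`, where the Hölder condition is available, until
  -- it reaches `x` at `s = 1`.
  have hcΓ : ∀ s ∈ Ico (0 : ℝ) 1, c s ∈ Γ := by
    intro s hs
    have hs' : s ∈ Icc (0 : ℝ) 1 := ⟨hs.1, hs.2.le⟩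
    obtain ⟨t, ht⟩ := hcrep s
    have hpos : 0 < c s 0 := by
      rw [ht]
      simp only [PiLp.add_apply, PiLp.smul_apply, PiLp.sub_apply, hx0, hn0, smul_eq_mul]
      have : 0 < 1 - s := sub_pos.2 hs.2
      simp only [zero_add, sub_zero, mul_zero, add_zero]
      positivity
    refine ((hΓ _ (hcz s hs').1).2 ⟨hpos.le, (hcz s hs').2⟩).resolve_right fun he => ?_
    exact hpos.ne' (h.zero_of_mem_edge _ he)
  -- The curve has Lipschitz constant `2ρ`, with `ρ = ‖ξ - x‖`, and stays within `2ρ` of `ξ`, so its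
  -- normals differ from `n ξ` by at most `A (2ρ)^λ`.
  have key := abs_inner_sub_le_of_curve (b := n ξ) (c := c) (N := fun s => n (c s))
    (L := 2 * ‖ξ - x‖) (D := A * (2 * ‖ξ - x‖) ^ lam) (by positivity) hclip ?_ ?_
  · rw [hc0, hc1] at key
    rw [real_inner_comm, ← abs_neg, ← inner_neg_right, neg_sub]
    refine key.trans (le_of_eq ?_)
    rw [Real.mul_rpow zero_le_two hρ.le, Real.rpow_add hρ, Real.rpow_one]
    ring
  · intro s hs ε hε
    have hs' : s ∈ Icc (0 : ℝ) 1 := ⟨hs.1, hs.2.le⟩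
    have hball := (hcz s hs').1
    have hd : DifferentiableAt ℝ φ (c s) :=
      (hφ.contDiffAt (Metric.isOpen_ball.mem_nhds hball)).differentiableAt one_ne_zero
    have hNpos : 0 < ‖gradient φ (c s)‖ := norm_pos_iff.2 (hN _ hball)
    have hlo := hd.hasFDerivAt.isLittleO.def (mul_pos hε hNpos)
    have hcont : Tendsto c (𝓝[>] s) (𝓝 (c s)) := by
      have h1 : ContinuousOn c (Icc 0 1) := by
        refine (LipschitzOnWith.of_dist_le_mul (K := (2 * ‖ξ - x‖).toNNReal)
          fun s hs s' hs' => ?_).continuousOn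
        rw [dist_eq_norm, Real.dist_eq, Real.coe_toNNReal _ (by positivity)]
        exact hclip s hs s' hs'
      refine (h1 s hs').mono_left ?_
      refine nhdsWithin_le_of_mem ?_
      filter_upwards [Ioo_mem_nhdsGT hs.2] with z hz
      exact ⟨hs.1.trans hz.1.le, hz.2.le⟩
    have hz : ∀ᶠ z in 𝓝[>] s, z ∈ Ioo s 1 := Ioo_mem_nhdsGT hs.2
    filter_upwards [hcont.eventually hlo, hz] with z h1 h2
    have hz' : z ∈ Icc (0 : ℝ) 1 := ⟨hs.1.trans h2.1.le, h2.2.le⟩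
    rw [(hcz z hz').2, (hcz s hs').2, sub_zero, zero_sub, norm_neg, Real.norm_eq_abs,
      ← inner_gradient_left] at h1
    rw [hnor _ ⟨Or.inl (hcΓ s hs), hball⟩, real_inner_smul_left, abs_mul,
      abs_of_pos (inv_pos.2 hNpos), inv_mul_le_iff₀ hNpos]
    linarith
  · intro s hs
    have hs' : s ∈ Icc (0 : ℝ) 1 := ⟨hs.1, hs.2.le⟩
    refine (norm_sub_le_angle (h.norm_normal (Or.inl hξ))
      (h.norm_normal (Or.inl (hcΓ s hs)))).trans ((hang ξ hξ _ (hcΓ s hs)).trans ?_)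
    gcongr
    rw [dist_eq_norm]
    have := hclip 0 (left_mem_Icc.2 zero_le_one) s hs'
    rw [hc0, zero_sub, abs_neg, abs_of_nonneg hs.1] at this
    nlinarith [hs.2, hρ]

end IsLyapunovDomain

/-! ### Integrability of powers of the distance on a surface -/

section NormPower

variable {E : Type*} [NormedAddCommGroup E] [InnerProductSpace ℝ E] [FiniteDimensional ℝ E]
  [MeasurableSpace E] [BorelSpace E]

lemma integrableOn_norm_sub_rpow_ball (hE : 0 < Module.finrank ℝ E) (y : E) {R β : ℝ} (hR : 0 < R)
    (hβ : -(Module.finrank ℝ E : ℝ) < β) :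
    IntegrableOn (fun z : E => ‖z - y‖ ^ β) (Metric.ball y R) := by
  have : Nontrivial E := Module.nontrivial_of_finrank_pos hE
  have h0 : IntegrableOn (fun z : E => ‖z‖ ^ β) (Metric.ball 0 R) := by
    rw [integrableOn_fun_norm_addHaar volume (f := fun t => t ^ β)]
    have h1 : IntegrableOn (fun t : ℝ => t ^ ((Module.finrank ℝ E : ℝ) - 1 + β)) (Ioo 0 R) :=
      (intervalIntegral.integrableOn_Ioo_rpow_iff hR).2 (by linarith)
    refine h1.congr_fun (fun t ht => ?_) measurableSet_Ioo
    change t ^ ((Module.finrank ℝ E : ℝ) - 1 + β) = t ^ (Module.finrank ℝ E - 1) • t ^ β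
    rw [Real.rpow_add ht.1, smul_eq_mul, ← Real.rpow_natCast, Nat.cast_sub hE, Nat.cast_one]
  have hmp := measurePreserving_sub_right (volume : Measure E) y
  have := (hmp.integrableOn_comp_preimage (MeasurableEquiv.subRight y).measurableEmbedding).2 h0
  convert! this using 1
  ext z
  simp [dist_eq_norm]

/-- Negative powers of the distance, above the critical one, are integrable on an almost flat
hypersurface. -/
lemma integrableOn_norm_sub_rpow_of_obliqueProj {n w : E} (hn : n ≠ 0) (hw : ⟪n, w⟫ = 1)
    (hE : 1 < Module.finrank ℝ E)
    {κ : ℝ≥0} {Z : Set E} (hZ : MeasurableSet Z) (hκ : κ ≤ 1 / 2) (hb : Bornology.IsBounded Z)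
    (h : ∀ q ∈ Z, ∀ q' ∈ Z, |⟪n, q - q'⟫| * ‖w‖ ≤ κ * ‖q - q'‖)
    (hinj : InjOn (obliqueProj n w) Z) {x : E} (hx : x ∈ Z) {β : ℝ} (hβ0 : β < 0)
    (hβ : -((Module.finrank ℝ E : ℝ) - 1) < β) :
    IntegrableOn (fun q => ‖q - x‖ ^ β) Z μHE[Module.finrank ℝ E - 1] := by
  set d := Module.finrank ℝ E - 1 with hd
  set P := obliqueProj n w
  set K : ℝ≥0 := 1 + 2 * κ with hK
  have hK0 : (0 : ℝ) < K := by rw [hK]; push_cast; positivity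
  have hfr : Module.finrank ℝ (ℝ ∙ n)ᗮ = d := by
    have := (ℝ ∙ n).finrank_add_finrank_orthogonal
    rw [finrank_span_singleton hn] at this
    omega
  have hPZm := measurableSet_image_of_injOn hZ P.continuous hinj
  have hPL : LipschitzOnWith K P Z := lipschitzOnWith_obliqueProj hw h
  have hGL : LipschitzOnWith K (Function.invFunOn P Z) (P '' Z) :=
    lipschitzOnWith_invFunOn_obliqueProj hw hκ h
  obtain ⟨R, hR, hPR⟩ : ∃ R > 0, P '' Z ⊆ Metric.ball (P x) R :=
    (P.lipschitz.isBounded_image hb).subset_ball_lt 0 (P x) |>.imp fun R hR => hR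
  have hball : IntegrableOn (fun y => ‖y - P x‖ ^ β) (P '' Z) μHE[d] := by
    rw [show (μHE[d] : Measure (ℝ ∙ n)ᗮ) = volume by
      rw [← hfr]; exact InnerProductSpace.euclideanHausdorffMeasure_eq_volume]
    refine (integrableOn_norm_sub_rpow_ball (by omega) (P x) hR ?_).mono_set hPR
    rw [hfr, hd, Nat.cast_sub hE.le, Nat.cast_one]
    exact hβ
  have hmeasE : Measurable fun q : E => ‖P q - P x‖ ^ β := by fun_prop
  have hmap : Integrable (fun q => ‖P q - P x‖ ^ β)
      ((μHE[d].restrict (P '' Z)).map (Function.invFunOn P Z)) := by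
    rw [integrable_map_measure hmeasE.aestronglyMeasurable (hGL.continuousOn.aemeasurable hPZm)]
    refine hball.congr_fun (fun y hy => ?_) hPZm
    simp only [Function.comp_apply]
    rw [Function.invFunOn_eq hy]
  have hint : IntegrableOn (fun q => ‖P q - P x‖ ^ β) Z μHE[d] :=
    (hmap.smul_measure_nnreal (c := K ^ d)).mono_measure
      (restrict_le_smul_map_restrict_image hPZm (fun q hq => hinj.leftInvOn_invFunOn hq) hGL d)
  refine Integrable.mono' (hint.const_mul ((K : ℝ) ^ (-β)))
    (by fun_prop : Measurable fun q : E => ‖q - x‖ ^ β).aestronglyMeasurable ?_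
  refine (ae_restrict_iff' hZ).2 (ae_of_all _ fun q hq => ?_)
  rw [Real.norm_of_nonneg (by positivity)]
  -- At the pole both powers are `0 ^ β = 0`, as `β ≠ 0`.
  by_cases hqx : q = x
  · simp [hqx, Real.zero_rpow hβ0.ne]
  have hPne : 0 < ‖P q - P x‖ := norm_pos_iff.2 (sub_ne_zero.2 fun he => hqx (hinj hq hx he))
  have hle : ‖P q - P x‖ ≤ K * ‖q - x‖ := by
    have := hPL.dist_le_mul q hq x hx
    rwa [dist_eq_norm, dist_eq_norm] at this
  have h1 : (K * ‖q - x‖) ^ β ≤ ‖P q - P x‖ ^ β :=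
    Real.rpow_le_rpow_of_nonpos hPne hle hβ0.le
  rw [Real.mul_rpow hK0.le (norm_nonneg _)] at h1
  rw [Real.rpow_neg hK0.le, le_inv_mul_iff₀ (by positivity)]
  exact h1

end NormPower

/-- The flux density `ξ₁^(2α) |ξ - x|^(-2α-m) ⟨ξ - x, n⟩`. -/
noncomputable def fluxDensity {m : ℕ} [NeZero m] (α : ℝ)
    (n : EuclideanSpace ℝ (Fin m) → EuclideanSpace ℝ (Fin m)) (x ξ : EuclideanSpace ℝ (Fin m)) : ℝ :=
  (ξ 0) ^ (2 * α) * (‖ξ - x‖ ^ 2) ^ (-(α + (m : ℝ) / 2)) * ⟪ξ - x, n ξ⟫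

/-! ### The fundamental solution with pole on the hyperplane -/

section Kernel

variable {m : ℕ} [NeZero m]

lemma rSq_eq_norm_sq {m : ℕ} (x ξ : EuclideanSpace ℝ (Fin m)) : rSq x ξ = ‖x - ξ‖ ^ 2 := by
  simp [rSq, EuclideanSpace.real_norm_sq_eq]

lemma rOneSq_eq_rSq {x ξ : EuclideanSpace ℝ (Fin m)} (hξ : ξ 0 = 0) : rOneSq x ξ = rSq x ξ := by
  rw [rOneSq, rSq, ← Finset.add_sum_erase _ _ (Finset.mem_univ (0 : Fin m)), hξ, add_zero, sub_zero]

lemma qOne_eq {α : ℝ} (hα : 0 < α) (hm : 2 < m) {x ξ : EuclideanSpace ℝ (Fin m)} (hξ : ξ 0 = 0) :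
    qOne α x ξ = kOne m α * (‖x - ξ‖ ^ 2) ^ (-α - ((m : ℝ) - 2) / 2) := by
  have hm' : (2 : ℝ) < m := by exact_mod_cast hm
  rw [qOne, rOneSq_eq_rSq hξ, rSq_eq_norm_sq]
  -- At the pole both sides are zero because of `0 ^ p = 0` for `p ≠ 0`; elsewhere the argument of
  -- `F` is `1 - 1 = 0`.
  by_cases h0 : ‖x - ξ‖ ^ 2 = 0
  · rw [h0, Real.zero_rpow (by linarith)]; simp
  · rw [div_self h0, sub_self, gaussF, if_pos (by simp)]
    simp [ordinaryHypergeometric_zero]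

lemma doubleLayerIntegrand_eq {α : ℝ} (hα : 0 < α) (hm : 2 < m)
    (n : EuclideanSpace ℝ (Fin m) → EuclideanSpace ℝ (Fin m)) {x ξ : EuclideanSpace ℝ (Fin m)}
    (hx : x 0 = 0) (hξ : ξ ≠ x) :
    doubleLayerIntegrand α n (fun _ => 1) x ξ =
      -(kOne m α * (2 * α + m - 2)) * fluxDensity α n x ξ := by
  have hne : ‖ξ - x‖ ^ 2 ≠ 0 := pow_ne_zero 2 (norm_ne_zero_iff.2 (sub_ne_zero.2 hξ))
  have hd : HasFDerivAt (fun η : EuclideanSpace ℝ (Fin m) => ‖η - x‖ ^ 2)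
      (2 • innerSL ℝ (ξ - x)) ξ := by
    simpa using ((hasFDerivAt_id ξ).sub_const x).norm_sq
  have hd2 := (hd.rpow_const (p := -α - ((m : ℝ) - 2) / 2) (Or.inl hne)).const_mul (kOne m α)
  have hfun : (fun η => qOne α η x) =
      fun η => kOne m α * (‖η - x‖ ^ 2) ^ (-α - ((m : ℝ) - 2) / 2) :=
    funext fun η => qOne_eq hα hm hx
  rw [doubleLayerIntegrand, hfun, hd2.fderiv, fluxDensity,
    show -α - ((m : ℝ) - 2) / 2 - 1 = -(α + (m : ℝ) / 2) by ring]
  simp only [nsmul_eq_mul, smul_apply, smul_eq_mul, innerSL_apply_apply, mul_one, Nat.cast_ofNat]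
  ring

end Kernel

/-! ### Absolute convergence of the flux integral -/

namespace IsLyapunovDomain

variable {m : ℕ} [NeZero m] {Ω Γ₁ Γ : Set (EuclideanSpace ℝ (Fin m))}
  {n : EuclideanSpace ℝ (Fin m) → EuclideanSpace ℝ (Fin m)}

lemma continuousOn_normal (h : IsLyapunovDomain Ω Γ₁ Γ n) : ContinuousOn n Γ := by
  intro p hp
  obtain ⟨-, r, φ, a, hr, -, -, hφ, hN, -, -, -, hnor⟩ := h.exists_flat_ball (Or.inl hp) one_pos
  have hball := Metric.ball_mem_nhds p hr
  have hc := (continuousOn_normalized_gradient Metric.isOpen_ball hφ hN).continuousAt hball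
  refine hc.continuousWithinAt.congr_of_eventuallyEq ?_ (hnor p ⟨Or.inl hp, mem_of_mem_nhds hball⟩)
  filter_upwards [mem_nhdsWithin_of_mem_nhds hball, self_mem_nhdsWithin] with q h1 h2
  exact hnor q ⟨Or.inl h2, h1⟩

lemma ne_of_mem_surface (h : IsLyapunovDomain Ω Γ₁ Γ n) {x ξ : EuclideanSpace ℝ (Fin m)}
    (hx : x 0 = 0) (hξ : ξ ∈ Γ) : ξ ≠ x := by
  rintro rfl
  exact (h.pos_of_mem_surface ξ hξ).ne' hx

lemma continuousOn_fluxDensity (h : IsLyapunovDomain Ω Γ₁ Γ n) {α : ℝ}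
    {x : EuclideanSpace ℝ (Fin m)} (hx : x 0 = 0) : ContinuousOn (fluxDensity α n x) Γ := by
  unfold fluxDensity
  refine (ContinuousOn.mul ?_ ?_).mul ?_
  · exact ContinuousOn.rpow_const (by fun_prop) fun ξ hξ =>
      Or.inl (h.pos_of_mem_surface ξ hξ).ne'
  · exact ContinuousOn.rpow_const (by fun_prop) fun ξ hξ => Or.inl
      (pow_ne_zero 2 (norm_ne_zero_iff.2 (sub_ne_zero.2 (h.ne_of_mem_surface hx hξ))))
  · exact (by fun_prop : ContinuousOn (fun ξ => ξ - x) Γ).inner h.continuousOn_normal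

/-- As `x` lies on the hyperplane, `ξ₁ ≤ ‖ξ - x‖`, so the degenerate weight compensates the extra
power and leaves the singularity of the classical double layer. -/
lemma abs_fluxDensity_le {α : ℝ} (hα : 0 < α) {x ξ : EuclideanSpace ℝ (Fin m)}
    (hx : x 0 = 0) (hξ : 0 < ξ 0) :
    |fluxDensity α n x ξ| ≤ ‖ξ - x‖ ^ (-(m : ℝ)) * |⟪ξ - x, n ξ⟫| := by
  have hle : ξ 0 ≤ ‖ξ - x‖ := by
    have := PiLp.norm_apply_le (ξ - x) 0
    simp only [PiLp.sub_apply, hx, sub_zero, Real.norm_eq_abs] at this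
    exact (le_abs_self _).trans this
  have hρ : 0 < ‖ξ - x‖ := hξ.trans_le hle
  rw [fluxDensity, abs_mul, abs_of_nonneg (by positivity)]
  gcongr
  rw [← Real.rpow_natCast, ← Real.rpow_mul hρ.le]
  calc ξ 0 ^ (2 * α) * ‖ξ - x‖ ^ (((2 : ℕ) : ℝ) * -(α + (m : ℝ) / 2))
      ≤ ‖ξ - x‖ ^ (2 * α) * ‖ξ - x‖ ^ (((2 : ℕ) : ℝ) * -(α + (m : ℝ) / 2)) := by gcongr
    _ = ‖ξ - x‖ ^ (-(m : ℝ)) := by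
      rw [← Real.rpow_add hρ]; congr 1; push_cast; ring

lemma abs_fluxDensity_le_rpow (h : IsLyapunovDomain Ω Γ₁ Γ n) {α : ℝ} (hα : 0 < α)
    {x ξ : EuclideanSpace ℝ (Fin m)} (hx : x 0 = 0) (hξ : ξ ∈ Γ) :
    |fluxDensity α n x ξ| ≤ ‖ξ - x‖ ^ (1 - (m : ℝ)) := by
  have hρ : 0 < ‖ξ - x‖ := norm_pos_iff.2 (sub_ne_zero.2 (h.ne_of_mem_surface hx hξ))
  refine (abs_fluxDensity_le hα hx (h.pos_of_mem_surface ξ hξ)).trans ?_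
  rw [show 1 - (m : ℝ) = -m + 1 by ring, Real.rpow_add hρ, Real.rpow_one]
  gcongr
  have := abs_real_inner_le_norm (ξ - x) (n ξ)
  rwa [h.norm_normal (Or.inl hξ), mul_one] at this

/-- Away from `x` the density is bounded and the area finite. Near an edge point the chord estimate
improves the crude exponent `1 - m`, critical for an `(m-1)`-dimensional surface, to an integrable
one. -/
lemma integrableOn_fluxDensity (h : IsLyapunovDomain Ω Γ₁ Γ n) {α : ℝ} (hα : 0 < α) (hm : 2 < m)
    {x : EuclideanSpace ℝ (Fin m)} (hx : x 0 = 0) :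
    IntegrableOn (fluxDensity α n x) Γ μHE[m - 1] := by
  have hm' : (2 : ℝ) < m := by exact_mod_cast hm
  have : IsFiniteMeasure (μHE[m - 1].restrict Γ) := ⟨by simpa using h.measure_surface_lt_top⟩
  have hmeas := (h.continuousOn_fluxDensity (α := α) hx).aestronglyMeasurable
    (μ := μHE[m - 1]) h.measurableSet_surface
  have hfar : ∀ r > 0, ∀ ξ ∈ Γ, r ≤ ‖ξ - x‖ → ‖fluxDensity α n x ξ‖ ≤ r ^ (1 - (m : ℝ)) := by
    intro r hr ξ hξ hle
    exact (h.abs_fluxDensity_le_rpow hα hx hξ).trans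
      (Real.rpow_le_rpow_of_nonpos hr hle (by linarith))
  by_cases hxΓ : x ∈ closure Γ
  · have hxe : x ∈ edge Γ₁ := by
      rw [h.closure_surface] at hxΓ
      exact hxΓ.resolve_left fun hΓ => (h.pos_of_mem_surface x hΓ).ne' hx
    obtain ⟨r₁, C, lam, hr₁, hlam, hC, hbound⟩ := h.exists_abs_inner_le hxe
    obtain ⟨hn, r₂, φ, a, hr₂, ha, -, hφ, hN, haff, hΓ, -⟩ :=
      h.exists_flat_ball (Or.inr hxe) (show (0 : ℝ) < 1 / 4 by norm_num)
    set r := min (min r₁ r₂) 1 with hr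
    have hr0 : 0 < r := lt_min (lt_min hr₁ hr₂) one_pos
    -- A Hölder exponent of at most `1` keeps `1 + μ - m` negative, since `m > 2`.
    set μ := min lam 1 with hμ
    have hμ0 : 0 < μ := lt_min hlam one_pos
    set Z := (Γ ∪ edge Γ₁) ∩ Metric.ball x r with hZ
    have hsub : Metric.ball x r ⊆ Metric.ball x r₂ :=
      Metric.ball_subset_ball ((min_le_left _ _).trans (min_le_right _ _))
    have hZm : MeasurableSet Z := by
      rw [hZ, ← h.closure_surface]
      exact isClosed_closure.measurableSet.inter measurableSet_ball
    have hnn : ⟪n x, n x⟫ = 1 := by rw [real_inner_self_eq_norm_sq, hn, one_pow]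
    have hZφ : Z ⊆ {q | q ∈ Metric.ball x r₂ ∧ φ q = 0} :=
      fun q hq => ⟨hsub hq.2, ((hΓ q (hsub hq.2)).1 hq.1).2⟩
    have hpow : IntegrableOn (fun q => ‖q - x‖ ^ (1 + μ - m)) Z μHE[m - 1] := by
      have := integrableOn_norm_sub_rpow_of_obliqueProj (κ := 1 / 4) (β := 1 + μ - m)
        (norm_ne_zero_iff.1 (by rw [hn]; exact one_ne_zero)) hnn
        (by rw [finrank_euclideanSpace_fin]; omega) hZm
        (by rw [← NNReal.coe_le_coe]; push_cast; norm_num)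
        (Metric.isBounded_ball.subset fun q hq => hq.2)
        (fun q hq q' hq' => by
          rw [hn, mul_one]
          simpa using abs_inner_le_of_almost_affine ha haff (hZφ hq).1 (hZφ hq').1
            ((hZφ hq).2.trans (hZφ hq').2.symm))
        ((injOn_obliqueProj hnn
          (lt_of_almost_affine ha haff hnn (by rw [hn]; norm_num))).mono hZφ)
        (show x ∈ Z from ⟨Or.inr hxe, Metric.mem_ball_self hr0⟩)
        (by have := min_le_right lam 1; linarith)
        (by rw [finrank_euclideanSpace_fin]; linarith)
      simpa using this
    have hnear : IntegrableOn (fluxDensity α n x) (Γ ∩ Metric.ball x r) μHE[m - 1] := by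
      have hsubZ : Γ ∩ Metric.ball x r ⊆ Z := inter_subset_inter_left _ subset_union_left
      refine Integrable.mono' ((hpow.mono_set hsubZ).const_mul C)
        (hmeas.mono_measure (Measure.restrict_mono inter_subset_left le_rfl)) ?_
      refine (ae_restrict_iff' (h.measurableSet_surface.inter measurableSet_ball)).2
        (ae_of_all _ fun ξ hξ => ?_)
      have hξr : ‖ξ - x‖ < r := by simpa [dist_eq_norm] using hξ.2
      have hρ : 0 < ‖ξ - x‖ := norm_pos_iff.2 (sub_ne_zero.2 (h.ne_of_mem_surface hx hξ.1))
      have hb := hbound ξ hξ.1 (hξr.trans_le ((min_le_left _ _).trans (min_le_left _ _)))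
      have h1 : ‖ξ - x‖ ^ (1 + lam) ≤ ‖ξ - x‖ ^ (1 + μ) :=
        Real.rpow_le_rpow_of_exponent_ge hρ (hξr.le.trans (min_le_right _ _))
          (by have := min_le_left lam 1; linarith)
      calc ‖fluxDensity α n x ξ‖ ≤ ‖ξ - x‖ ^ (-(m : ℝ)) * |⟪ξ - x, n ξ⟫| :=
            abs_fluxDensity_le hα hx (h.pos_of_mem_surface ξ hξ.1)
        _ ≤ ‖ξ - x‖ ^ (-(m : ℝ)) * (C * ‖ξ - x‖ ^ (1 + μ)) := by
            gcongr
            exact hb.trans (mul_le_mul_of_nonneg_left h1 hC)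
        _ = C * ‖ξ - x‖ ^ (1 + μ - m) := by
            rw [show 1 + μ - (m : ℝ) = -m + (1 + μ) by ring, Real.rpow_add hρ (-(m : ℝ)) (1 + μ)]
            ring
    have hfar' : IntegrableOn (fluxDensity α n x) (Γ \ Metric.ball x r) μHE[m - 1] := by
      have : IsFiniteMeasure (μHE[m - 1].restrict (Γ \ Metric.ball x r)) :=
        ⟨by simpa using (measure_mono sdiff_subset).trans_lt h.measure_surface_lt_top⟩
      refine Integrable.of_bound
        (hmeas.mono_measure (Measure.restrict_mono sdiff_subset le_rfl)) (r ^ (1 - (m : ℝ))) ?_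
      refine (ae_restrict_iff' (h.measurableSet_surface.diff measurableSet_ball)).2
        (ae_of_all _ fun ξ hξ => hfar r hr0 ξ hξ.1 ?_)
      simpa [dist_eq_norm] using hξ.2
    have := hnear.union hfar'
    rwa [inter_union_sdiff] at this
  · obtain ⟨r, hr, hball⟩ := Metric.mem_nhds_iff.1
      (isClosed_closure.isOpen_compl.mem_nhds (show x ∈ (closure Γ)ᶜ from hxΓ))
    refine Integrable.of_bound hmeas (r ^ (1 - (m : ℝ)))
      ((ae_restrict_iff' h.measurableSet_surface).2 (ae_of_all _ fun ξ hξ => hfar r hr ξ hξ ?_))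
    by_contra! hlt
    exact hball (by simpa [dist_eq_norm] using hlt) (subset_closure hξ)

end IsLyapunovDomain

/-! ### The cutoff function -/

section Cutoff

/-- A smooth monotone function that vanishes on `(-∞, 1]` and equals `1` on `[2, ∞)`. -/
noncomputable def cutoff (t : ℝ) : ℝ := Real.smoothTransition (t - 1)

lemma contDiff_cutoff {k : ℕ∞} : ContDiff ℝ k cutoff :=
  Real.smoothTransition.contDiff.comp (contDiff_id.sub contDiff_const)

lemma cutoff_of_le_one {t : ℝ} (ht : t ≤ 1) : cutoff t = 0 :=
  Real.smoothTransition.zero_of_nonpos (by linarith)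

lemma cutoff_of_two_le {t : ℝ} (ht : 2 ≤ t) : cutoff t = 1 :=
  Real.smoothTransition.one_of_one_le (by linarith)

lemma cutoff_nonneg (t : ℝ) : 0 ≤ cutoff t := Real.smoothTransition.nonneg _

lemma cutoff_le_one (t : ℝ) : cutoff t ≤ 1 := Real.smoothTransition.le_one _

lemma hasDerivAt_cutoff (t : ℝ) : HasDerivAt cutoff (deriv cutoff t) t :=
  ((contDiff_cutoff (k := 1)).differentiable one_ne_zero t).hasDerivAt

lemma continuous_deriv_cutoff : Continuous (deriv cutoff) :=
  (contDiff_cutoff (k := 1)).continuous_deriv le_rfl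

lemma deriv_cutoff_of_lt_one {t : ℝ} (ht : t < 1) : deriv cutoff t = 0 := by
  have : cutoff =ᶠ[𝓝 t] fun _ => 0 := by
    filter_upwards [Iio_mem_nhds ht] with s hs using cutoff_of_le_one (le_of_lt hs)
  rw [this.deriv_eq, deriv_const]

lemma deriv_cutoff_of_two_lt {t : ℝ} (ht : 2 < t) : deriv cutoff t = 0 := by
  have : cutoff =ᶠ[𝓝 t] fun _ => 1 := by
    filter_upwards [Ioi_mem_nhds ht] with s hs using cutoff_of_two_le (le_of_lt hs)
  rw [this.deriv_eq, deriv_const]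

lemma monotone_cutoff : Monotone cutoff := by
  intro s t hst
  exact Real.smoothTransition.monotone (by linarith)

lemma deriv_cutoff_nonneg (t : ℝ) : 0 ≤ deriv cutoff t :=
  monotone_cutoff.deriv_nonneg

lemma integrable_deriv_cutoff : Integrable (deriv cutoff) := by
  refine continuous_deriv_cutoff.integrable_of_hasCompactSupport
    (HasCompactSupport.intro (isCompact_Icc (a := 1) (b := 2)) fun t ht => ?_)
  rcases lt_or_ge t 1 with h | h
  · exact deriv_cutoff_of_lt_one h
  · exact deriv_cutoff_of_two_lt (not_le.1 fun h' => ht ⟨h, h'⟩)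

lemma integral_deriv_cutoff : ∫ t, deriv cutoff t = 1 := by
  have := integral_of_hasDerivAt_of_tendsto (m := 0) (n := 1) hasDerivAt_cutoff
    integrable_deriv_cutoff ?_ ?_
  · simpa using this
  · refine tendsto_const_nhds.congr' ?_
    filter_upwards [eventually_le_atBot 1] with t ht using (cutoff_of_le_one ht).symm
  · refine tendsto_const_nhds.congr' ?_
    filter_upwards [eventually_ge_atTop 2] with t ht using (cutoff_of_two_le ht).symm

end Cutoff

/-! ### A Euclidean integral by way of Gaussians -/

section GaussianIntegral

variable {F : Type*} [NormedAddCommGroup F] [InnerProductSpace ℝ F] [FiniteDimensional ℝ F]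
  [MeasurableSpace F] [BorelSpace F]

/-- A nonzero Bochner integral forces integrability, since the integral of a non-integrable function
is `0` by convention. -/
lemma integrable_exp_neg_mul_norm_sq {b : ℝ} (hb : 0 < b) :
    Integrable fun y : F => Real.exp (-b * ‖y‖ ^ 2) := by
  by_contra hn
  have := GaussianFourier.integral_rexp_neg_mul_sq_norm (V := F) hb
  rw [integral_undef hn] at this
  have hpos : 0 < (Real.pi / b) ^ (Module.finrank ℝ F / 2 : ℝ) := by positivity
  exact hpos.ne this

lemma integrableOn_rpow_mul_exp_neg_mul {a r : ℝ} (ha : 0 < a) (hr : 0 < r) :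
    IntegrableOn (fun s : ℝ => s ^ (a - 1) * Real.exp (-(r * s))) (Ioi 0) := by
  by_contra hn
  have := Real.integral_rpow_mul_exp_neg_mul_Ioi ha hr
  rw [integral_undef hn] at this
  have hpos : 0 < (1 / r) ^ a * Real.Gamma a := by
    have := Real.Gamma_pos_of_pos ha
    positivity
  exact hpos.ne this

/-- The integral of `(t² + |y|²)^(-β)` over a Euclidean space. -/
lemma integrable_and_integral_sq_add_norm_sq_rpow {β t : ℝ} (ht : 0 < t)
    (hβ : (Module.finrank ℝ F : ℝ) / 2 < β) :
    Integrable (fun y : F => (t ^ 2 + ‖y‖ ^ 2) ^ (-β)) ∧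
      ∫ y : F, (t ^ 2 + ‖y‖ ^ 2) ^ (-β) =
        Real.pi ^ ((Module.finrank ℝ F : ℝ) / 2) * Real.Gamma (β - Module.finrank ℝ F / 2) /
          Real.Gamma β * (t ^ 2) ^ (-(β - (Module.finrank ℝ F : ℝ) / 2)) := by
  set d : ℝ := (Module.finrank ℝ F : ℝ) / 2 with hd
  have hd0 : 0 ≤ d := by positivity
  have hβ0 : 0 < β := hd0.trans_lt hβ
  have hΓ := Real.Gamma_pos_of_pos hβ0
  -- From `A^(-β) Γ(β) = ∫ s^(β-1) e^(-As) ds` with `A = t² + ‖y‖²`: integrating first in `y` leaves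
  -- a Gaussian, and then another Gamma integral in `s`.
  set G : ℝ × F → ℝ := fun p => p.1 ^ (β - 1) * Real.exp (-((t ^ 2 + ‖p.2‖ ^ 2) * p.1)) with hG
  have hsplit : ∀ (s : ℝ) (y : F), G (s, y) =
      s ^ (β - 1) * Real.exp (-(t ^ 2 * s)) * Real.exp (-s * ‖y‖ ^ 2) := by
    intro s y
    simp only [hG]
    rw [mul_assoc, ← Real.exp_add]
    congr 2; ring
  have hinner : ∀ s ∈ Ioi (0 : ℝ), ∫ y : F, G (s, y) =
      Real.pi ^ d * (s ^ (β - d - 1) * Real.exp (-(t ^ 2 * s))) := by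
    intro s hs
    have hs : 0 < s := hs
    simp_rw [hsplit]
    rw [integral_const_mul, GaussianFourier.integral_rexp_neg_mul_sq_norm hs, ← hd,
      Real.div_rpow Real.pi_pos.le hs.le, show β - d - 1 = (β - 1) - d by ring,
      Real.rpow_sub hs (β - 1) d]
    field_simp
  have hGnn : ∀ s ∈ Ioi (0 : ℝ), ∀ y, 0 ≤ G (s, y) := fun s hs y =>
    mul_nonneg (Real.rpow_nonneg (le_of_lt hs) _) (Real.exp_nonneg _)
  have hGm : Measurable G := by fun_prop
  have hGint : Integrable G ((volume.restrict (Ioi 0)).prod volume) := by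
    rw [integrable_prod_iff hGm.aestronglyMeasurable]
    constructor
    · refine (ae_restrict_iff' measurableSet_Ioi).2 (ae_of_all _ fun s hs => ?_)
      simp_rw [hsplit]
      exact (integrable_exp_neg_mul_norm_sq hs).const_mul _
    · have : IntegrableOn (fun s : ℝ => Real.pi ^ d * (s ^ (β - d - 1) * Real.exp (-(t ^ 2 * s))))
          (Ioi 0) := (integrableOn_rpow_mul_exp_neg_mul (by linarith) (by positivity)).const_mul _
      refine this.congr_fun (fun s hs => ?_) measurableSet_Ioi
      simp only
      rw [← hinner s hs]
      exact integral_congr_ae (ae_of_all _ fun y => (Real.norm_of_nonneg (hGnn s hs y)).symm)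
  have houter : ∀ y : F, ∫ s in Ioi 0, G (s, y) = (t ^ 2 + ‖y‖ ^ 2) ^ (-β) * Real.Gamma β := by
    intro y
    have hpos : 0 < t ^ 2 + ‖y‖ ^ 2 := by positivity
    have := Real.integral_rpow_mul_exp_neg_mul_Ioi hβ0 hpos
    rw [one_div, Real.inv_rpow hpos.le, ← Real.rpow_neg hpos.le] at this
    exact this
  have hrepr : (fun y : F => (t ^ 2 + ‖y‖ ^ 2) ^ (-β)) =
      fun y => (Real.Gamma β)⁻¹ * ∫ s in Ioi 0, G (s, y) := by
    funext y
    rw [houter]; field_simp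
  rw [hrepr]
  refine ⟨hGint.integral_prod_right.const_mul _, ?_⟩
  rw [integral_const_mul, ← integral_integral_swap (f := fun s y => G (s, y)) hGint,
    setIntegral_congr_fun measurableSet_Ioi hinner, integral_const_mul,
    Real.integral_rpow_mul_exp_neg_mul_Ioi (by linarith) (by positivity), one_div,
    Real.inv_rpow (by positivity), ← Real.rpow_neg (by positivity)]
  field_simp

end GaussianIntegral

/-! ### The limit kernel and its total mass -/

section HalfSpaceKernel

variable {m : ℕ} [NeZero m]

/-- The rescaled divergence of the cut off flux field. -/
noncomputable def halfSpaceKernel (m : ℕ) [NeZero m] (α : ℝ) (z : EuclideanSpace ℝ (Fin m)) : ℝ :=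
  deriv cutoff (z 0) * z 0 * (z 0) ^ (2 * α) * (‖z‖ ^ 2) ^ (-(α + (m : ℝ) / 2))

lemma halfSpaceKernel_of_nonpos {α : ℝ} {z : EuclideanSpace ℝ (Fin m)} (hz : z 0 ≤ 0) :
    halfSpaceKernel m α z = 0 := by
  rw [halfSpaceKernel, deriv_cutoff_of_lt_one (by linarith)]
  simp

lemma measurable_halfSpaceKernel (α : ℝ) : Measurable (halfSpaceKernel m α) := by
  have := continuous_deriv_cutoff.measurable
  unfold halfSpaceKernel
  fun_prop

/-- On the slice `z₁ = t` the integral over the remaining variables is a constant times `t^(-1-2α)`,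
which cancels `t · t^(2α)`. What remains is the integral of the derivative of the cutoff, which is
`1`. -/
lemma integrable_and_integral_halfSpaceKernel {α : ℝ} (hα : 0 < α) :
    Integrable (halfSpaceKernel m α) ∧ ∫ z, halfSpaceKernel m α z =
      Real.pi ^ (((m : ℝ) - 1) / 2) * Real.Gamma (α + 1 / 2) / Real.Gamma (α + (m : ℝ) / 2) := by
  set e : EuclideanSpace ℝ (Fin m) := EuclideanSpace.single 0 1 with he
  have hen : ‖e‖ = 1 := by simp [he]
  have hee : ⟪e, e⟫ = 1 := by rw [real_inner_self_eq_norm_sq, hen, one_pow]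
  have hmp := measurePreserving_add_smul hen hee
  have hm1 : 1 ≤ m := Nat.one_le_iff_ne_zero.2 (NeZero.ne m)
  have hfr : Module.finrank ℝ (ℝ ∙ e)ᗮ = m - 1 := by
    have := (ℝ ∙ e).finrank_add_finrank_orthogonal
    rw [finrank_span_singleton (norm_ne_zero_iff.1 (by rw [hen]; exact one_ne_zero)),
      finrank_euclideanSpace_fin] at this
    omega
  have hfr' : (Module.finrank ℝ (ℝ ∙ e)ᗮ : ℝ) / 2 = ((m : ℝ) - 1) / 2 := by
    rw [hfr, Nat.cast_sub hm1, Nat.cast_one]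
  set c := Real.pi ^ (((m : ℝ) - 1) / 2) * Real.Gamma (α + 1 / 2) /
    Real.Gamma (α + (m : ℝ) / 2) with hc
  have hcoord : ∀ (t : ℝ) (y : (ℝ ∙ e)ᗮ), ((y : EuclideanSpace ℝ (Fin m)) + t • e) 0 = t := by
    intro t y
    have hy : ⟪e, (y : EuclideanSpace ℝ (Fin m))⟫ = 0 :=
      mem_orthogonal_singleton_iff_inner_right.1 y.2
    have hz : ∀ z : EuclideanSpace ℝ (Fin m), z 0 = ⟪e, z⟫ := fun z => by
      simp [he, EuclideanSpace.inner_single_left]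
    rw [hz, inner_add_right, inner_smul_right, hy, hee]
    ring
  have hnorm : ∀ (t : ℝ) (y : (ℝ ∙ e)ᗮ),
      ‖(y : EuclideanSpace ℝ (Fin m)) + t • e‖ ^ 2 = t ^ 2 + ‖y‖ ^ 2 := by
    intro t y
    have hy : ⟪(y : EuclideanSpace ℝ (Fin m)), e⟫ = 0 :=
      mem_orthogonal_singleton_iff_inner_left.1 y.2
    rw [norm_add_sq_real, inner_smul_right, hy, norm_smul, hen, Real.norm_eq_abs, mul_one, sq_abs]
    simp only [coe_norm]
    ring
  have hval : ∀ (t : ℝ) (y : (ℝ ∙ e)ᗮ), halfSpaceKernel m α (y + t • e) =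
      deriv cutoff t * t * t ^ (2 * α) * (t ^ 2 + ‖y‖ ^ 2) ^ (-(α + (m : ℝ) / 2)) := by
    intro t y
    rw [halfSpaceKernel, hcoord, hnorm]
  have hker : ∀ t > (0 : ℝ), _ := fun t (ht : 0 < t) =>
    integrable_and_integral_sq_add_norm_sq_rpow (F := (ℝ ∙ e)ᗮ) (β := α + (m : ℝ) / 2) ht
      (by rw [hfr']; linarith)
  have hinner : ∀ t : ℝ, ∫ y : (ℝ ∙ e)ᗮ, halfSpaceKernel m α (y + t • e) = deriv cutoff t * c := by
    intro t
    simp_rw [hval]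
    rcases lt_or_ge t 1 with h | h
    · simp [deriv_cutoff_of_lt_one h]
    · have ht : 0 < t := by linarith
      rw [integral_const_mul, (hker t ht).2, hfr',
        show α + (m : ℝ) / 2 - ((m : ℝ) - 1) / 2 = α + 1 / 2 by ring, ← hc,
        ← Real.rpow_natCast, ← Real.rpow_mul ht.le]
      have h1 : t * t ^ (2 * α) * t ^ (((2 : ℕ) : ℝ) * -(α + 1 / 2)) = 1 := by
        rw [show t * t ^ (2 * α) = t ^ (1 + 2 * α) by rw [Real.rpow_add ht, Real.rpow_one],
          ← Real.rpow_add ht]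
        convert Real.rpow_zero t using 2
        push_cast; ring
      linear_combination (deriv cutoff t * c) * h1
  have hnn : ∀ (t : ℝ) (y : (ℝ ∙ e)ᗮ), 0 ≤ halfSpaceKernel m α (y + t • e) := by
    intro t y
    rw [hval]
    rcases lt_or_ge t 1 with h | h
    · simp [deriv_cutoff_of_lt_one h]
    · have ht : 0 < t := by linarith
      have := deriv_cutoff_nonneg t
      positivity
  have hint : Integrable (fun p : ℝ × (ℝ ∙ e)ᗮ => halfSpaceKernel m α (p.2 + p.1 • e))
      (volume.prod volume) := by
    rw [integrable_prod_iff]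
    · constructor
      · refine ae_of_all _ fun t => ?_
        simp_rw [hval]
        rcases lt_or_ge t 1 with h | h
        · simp [deriv_cutoff_of_lt_one h]
        · exact (hker t (by linarith)).1.const_mul _
      · simp_rw [fun (t : ℝ) (y : (ℝ ∙ e)ᗮ) => Real.norm_of_nonneg (hnn t y), hinner]
        exact integrable_deriv_cutoff.mul_const c
    · exact ((measurable_halfSpaceKernel α).comp hmp.measurable).aestronglyMeasurable
  have hint' : Integrable (halfSpaceKernel m α) :=
    (hmp.integrable_comp (measurable_halfSpaceKernel α).aestronglyMeasurable).1 hint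
  refine ⟨hint', ?_⟩
  rw [← hmp.map_eq, integral_map hmp.measurable.aemeasurable
    (measurable_halfSpaceKernel α).aestronglyMeasurable, integral_prod _ hint]
  simp_rw [hinner]
  rw [integral_mul_const, integral_deriv_cutoff, one_mul]

end HalfSpaceKernel

/-! ### The cut off field and its divergence -/

section CutField

variable {m : ℕ} [NeZero m]

/-- The factor `ζ(ξ₁/ε) ξ₁^(2α) |ξ - x|^(-2α-m)` of the cut off flux field. -/
noncomputable def cutWeight (α ε : ℝ) (x ξ : EuclideanSpace ℝ (Fin m)) : ℝ :=
  cutoff (ξ 0 / ε) * (ξ 0) ^ (2 * α) * (‖ξ - x‖ ^ 2) ^ (-(α + (m : ℝ) / 2))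

lemma cutWeight_of_le {α ε : ℝ} (hε : 0 < ε) {x ξ : EuclideanSpace ℝ (Fin m)} (hξ : ξ 0 ≤ ε) :
    cutWeight α ε x ξ = 0 := by
  rw [cutWeight, cutoff_of_le_one ((div_le_one hε).2 hξ)]
  simp

/-- The cutoff removes the region `ξ₁ ≤ ε`, which contains both the singular hyperplane of `ξ₁^(2α)`
and the pole `x`. -/
lemma contDiff_cutWeight {α ε : ℝ} (hε : 0 < ε) {x : EuclideanSpace ℝ (Fin m)} (hx : x 0 = 0) :
    ContDiff ℝ 1 (cutWeight α ε x) := by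
  rw [contDiff_iff_contDiffAt]
  intro ξ
  have hcoord : ContDiffAt ℝ 1 (fun ξ : EuclideanSpace ℝ (Fin m) => ξ 0) ξ := by fun_prop
  rcases lt_or_ge (ξ 0) ε with h | h
  · have hev : cutWeight α ε x =ᶠ[𝓝 ξ] fun _ => 0 := by
      have : ∀ᶠ η : EuclideanSpace ℝ (Fin m) in 𝓝 ξ, η 0 < ε :=
        (isOpen_lt (by fun_prop : Continuous fun η : EuclideanSpace ℝ (Fin m) => η 0)
          continuous_const).mem_nhds h
      filter_upwards [this] with η hη using cutWeight_of_le hε hη.le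
    exact contDiffAt_const.congr_of_eventuallyEq hev
  · have hξ : 0 < ξ 0 := hε.trans_le h
    have hne : ξ - x ≠ 0 := by
      refine sub_ne_zero.2 ?_
      rintro rfl
      exact hξ.ne' hx
    unfold cutWeight
    refine ContDiffAt.mul (ContDiffAt.mul ?_ ?_) ?_
    · exact (contDiff_cutoff (k := 1)).contDiffAt.comp ξ (hcoord.div_const ε)
    · exact hcoord.rpow_const_of_ne hξ.ne'
    · exact ((contDiffAt_id.sub contDiffAt_const).norm_sq ℝ).rpow_const_of_ne
        (pow_ne_zero 2 (norm_ne_zero_iff.2 hne))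

lemma tsupport_cutWeight_subset {α ε : ℝ} (hε : 0 < ε) (x : EuclideanSpace ℝ (Fin m)) :
    tsupport (cutWeight α ε x) ⊆ {ξ | 0 < ξ 0} := by
  have hcl : IsClosed {ξ : EuclideanSpace ℝ (Fin m) | ε ≤ ξ 0} :=
    isClosed_le continuous_const (by fun_prop)
  refine (closure_minimal (fun ξ hξ => ?_) hcl).trans fun ξ hξ => hε.trans_le hξ
  by_contra hlt
  exact hξ (cutWeight_of_le hε (not_le.1 hlt).le)

/-- The Euler identity for the cut off weight. -/
lemma fderiv_cutWeight_apply {α ε : ℝ} (hε : 0 < ε) {x ξ : EuclideanSpace ℝ (Fin m)}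
    (hx : x 0 = 0) (hξ : 0 < ξ 0) :
    fderiv ℝ (cutWeight α ε x) ξ (ξ - x) + m * cutWeight α ε x ξ =
      deriv cutoff (ξ 0 / ε) * (ξ 0 / ε) * (ξ 0) ^ (2 * α) *
        (‖ξ - x‖ ^ 2) ^ (-(α + (m : ℝ) / 2)) := by
  set B := (ξ 0) ^ (2 * α) * (‖ξ - x‖ ^ 2) ^ (-(α + (m : ℝ) / 2)) with hB
  have hline : HasDerivAt (fun t : ℝ => x + t • (ξ - x)) (ξ - x) 1 := by
    simpa using ((hasDerivAt_id (1 : ℝ)).smul_const (ξ - x)).const_add x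
  have h1 : HasDerivAt (fun t : ℝ => cutWeight α ε x (x + t • (ξ - x)))
      (fderiv ℝ (cutWeight α ε x) ξ (ξ - x)) 1 := by
    have hd : HasFDerivAt (cutWeight α ε x) (fderiv ℝ (cutWeight α ε x) ξ)
        (x + (1 : ℝ) • (ξ - x)) := by
      rw [one_smul, add_sub_cancel]
      exact ((contDiff_cutWeight hε hx).differentiable one_ne_zero ξ).hasFDerivAt
    exact hd.comp_hasDerivAt (1 : ℝ) hline
  -- Along the ray from `x` the weight without the cutoff scales as `t^(-m)`; its derivative at `t =
  -- 1` cancels the term `m g`, and only the derivative of the cutoff survives.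
  have hev : (fun t : ℝ => cutWeight α ε x (x + t • (ξ - x))) =ᶠ[𝓝 1]
      fun t => cutoff (t * (ξ 0 / ε)) * t ^ (-(m : ℝ)) * B := by
    filter_upwards [Ioi_mem_nhds (zero_lt_one' ℝ)] with t ht
    have ht : 0 < t := ht
    have hc : (x + t • (ξ - x)) 0 = t * ξ 0 := by
      simp [hx]
    rw [cutWeight, hc, add_sub_cancel_left, norm_smul, Real.norm_of_nonneg ht.le, mul_pow,
      Real.mul_rpow ht.le hξ.le, Real.mul_rpow (by positivity) (by positivity), mul_div_assoc,
      ← Real.rpow_natCast t 2, ← Real.rpow_mul ht.le, hB]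
    have : t ^ (2 * α) * t ^ (((2 : ℕ) : ℝ) * -(α + (m : ℝ) / 2)) = t ^ (-(m : ℝ)) := by
      rw [← Real.rpow_add ht]; congr 1; push_cast; ring
    rw [← this]
    ring
  have h2 : HasDerivAt (fun t : ℝ => cutoff (t * (ξ 0 / ε)) * t ^ (-(m : ℝ)) * B)
      ((deriv cutoff (ξ 0 / ε) * (ξ 0 / ε) - m * cutoff (ξ 0 / ε)) * B) 1 := by
    have hA : HasDerivAt (fun t : ℝ => cutoff (t * (ξ 0 / ε)))
        (deriv cutoff (ξ 0 / ε) * (ξ 0 / ε)) 1 := by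
      have hi : HasDerivAt (fun t : ℝ => t * (ξ 0 / ε)) (ξ 0 / ε) 1 := by
        simpa using (hasDerivAt_id (1 : ℝ)).mul_const (ξ 0 / ε)
      have ho := hasDerivAt_cutoff ((1 : ℝ) * (ξ 0 / ε))
      have := ho.comp (1 : ℝ) hi
      rwa [one_mul] at this
    have hR : HasDerivAt (fun t : ℝ => t ^ (-(m : ℝ))) (-(m : ℝ)) 1 := by
      simpa using Real.hasDerivAt_rpow_const (x := 1) (p := -(m : ℝ)) (Or.inl one_ne_zero)
    have := (hA.mul hR).mul_const B
    refine this.congr_deriv ?_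
    simp only [one_mul, Real.one_rpow]
    ring
  have h3 := (h1.congr_of_eventuallyEq hev.symm).unique h2
  rw [h3, cutWeight, hB]
  ring

end CutField

/-! ### The divergence theorem for the cut off field, and rescaling -/

namespace IsLyapunovDomain

variable {m : ℕ} [NeZero m] {Ω Γ₁ Γ : Set (EuclideanSpace ℝ (Fin m))}
  {n : EuclideanSpace ℝ (Fin m) → EuclideanSpace ℝ (Fin m)}

/-- The divergence theorem for the field `g(ξ) (ξ - x)`. -/
lemma setIntegral_divergence_smul_sub (h : IsLyapunovDomain Ω Γ₁ Γ n)
    {g : EuclideanSpace ℝ (Fin m) → ℝ} (hg : ContDiff ℝ 1 g)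
    (hgpos : tsupport g ⊆ {ξ | 0 < ξ 0}) (x : EuclideanSpace ℝ (Fin m)) :
    ∫ ξ in Ω, (fderiv ℝ g ξ (ξ - x) + m * g ξ) =
      ∫ ξ in Γ, g ξ * ⟪ξ - x, n ξ⟫ ∂μHE[m - 1] := by
  have hK : IsCompact (closure Ω) := h.isBounded.isCompact_closure
  have hfinΓ : IsFiniteMeasure (μHE[m - 1].restrict Γ) :=
    ⟨by simpa using h.measure_surface_lt_top⟩
  set e : Fin m → EuclideanSpace ℝ (Fin m) := fun i => EuclideanSpace.single i 1
  set u : Fin m → EuclideanSpace ℝ (Fin m) → ℝ := fun i ξ => g ξ * (ξ i - x i)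
  have hu : ∀ i, ContDiff ℝ 1 (u i) := fun i => hg.mul (by fun_prop)
  have hupos : ∀ i, tsupport (u i) ⊆ {ξ | 0 < ξ 0} := fun i =>
    (closure_mono fun ξ hξ => left_ne_zero_of_mul hξ).trans hgpos
  have hsumv : ∀ v : EuclideanSpace ℝ (Fin m), ∑ i, v i • e i = v := by
    intro v
    have := (EuclideanSpace.basisFun (Fin m) ℝ).sum_repr v
    simpa using this
  have hderiv : ∀ ξ, fderiv ℝ g ξ (ξ - x) + m * g ξ = ∑ i, fderiv ℝ (u i) ξ (e i) := by
    intro ξ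
    have hd : ∀ i, fderiv ℝ (u i) ξ (e i) = (ξ i - x i) * fderiv ℝ g ξ (e i) + g ξ := by
      intro i
      have hpi : HasFDerivAt (fun ξ : EuclideanSpace ℝ (Fin m) => ξ i - x i)
          (EuclideanSpace.proj i : EuclideanSpace ℝ (Fin m) →L[ℝ] ℝ) ξ :=
        (EuclideanSpace.proj i : EuclideanSpace ℝ (Fin m) →L[ℝ] ℝ).hasFDerivAt.sub_const (x i)
      have := ((hg.differentiable one_ne_zero ξ).hasFDerivAt.mul hpi).fderiv
      change fderiv ℝ (u i) ξ = _ at this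
      rw [this]
      simp [e]
      ring
    simp_rw [hd, Finset.sum_add_distrib]
    conv_lhs => rw [← hsumv (ξ - x)]
    rw [map_sum]
    simp
  have hflux : ∀ ξ, g ξ * ⟪ξ - x, n ξ⟫ = ∑ i, u i ξ * ⟪e i, n ξ⟫ := by
    intro ξ
    conv_lhs => rw [← hsumv (ξ - x)]
    rw [sum_inner, Finset.mul_sum]
    refine Finset.sum_congr rfl fun i _ => ?_
    rw [real_inner_smul_left]
    simp [u]
    ring
  have hintΩ : ∀ i ∈ Finset.univ, IntegrableOn (fun ξ => fderiv ℝ (u i) ξ (e i)) Ω := by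
    intro i _
    have hc : Continuous fun ξ => fderiv ℝ (u i) ξ (e i) :=
      ((hu i).continuous_fderiv one_ne_zero).clm_apply continuous_const
    exact (hc.continuousOn.integrableOn_compact hK).mono_set subset_closure
  have hintΓ : ∀ i ∈ Finset.univ, IntegrableOn (fun ξ => u i ξ * ⟪e i, n ξ⟫) Γ μHE[m - 1] := by
    intro i _
    obtain ⟨C, hC⟩ := hK.exists_bound_of_continuousOn (hu i).continuous.continuousOn
    refine Integrable.of_bound (C := C) (ContinuousOn.aestronglyMeasurable
      ((hu i).continuous.continuousOn.mul
        (continuousOn_const.inner h.continuousOn_normal)) h.measurableSet_surface)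
      ((ae_restrict_iff' h.measurableSet_surface).2 (ae_of_all _ fun ξ hξ => ?_))
    rw [norm_mul]
    have h1 := hC ξ (h.surface_subset_closure hξ)
    have h2 : ‖⟪e i, n ξ⟫‖ ≤ 1 := by
      have := norm_inner_le_norm (𝕜 := ℝ) (e i) (n ξ)
      rw [h.norm_normal (Or.inl hξ)] at this
      simpa [e] using this
    calc ‖u i ξ‖ * ‖⟪e i, n ξ⟫‖ ≤ C * 1 :=
          mul_le_mul h1 h2 (norm_nonneg _) ((norm_nonneg _).trans h1)
      _ = C := mul_one C
  simp_rw [hderiv, hflux]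
  rw [integral_finsetSum _ hintΩ, integral_finsetSum _ hintΓ]
  exact Finset.sum_congr rfl fun i _ => h.setIntegral_fderiv_eq (hu i) (hupos i) (e i)

/-- The cut off flux through the surface as a volume integral over the rescaled domain. -/
lemma setIntegral_cutoff_mul_fluxDensity (h : IsLyapunovDomain Ω Γ₁ Γ n) {α ε : ℝ} (hε : 0 < ε)
    {x : EuclideanSpace ℝ (Fin m)} (hx : x 0 = 0) :
    ∫ ξ in Γ, cutoff (ξ 0 / ε) * fluxDensity α n x ξ ∂μHE[m - 1] =
      ∫ z, indicator ((fun z => x + ε • z) ⁻¹' Ω) (halfSpaceKernel m α) z := by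
  have h1 := h.setIntegral_divergence_smul_sub (contDiff_cutWeight (α := α) hε hx)
    (tsupport_cutWeight_subset hε x) x
  have h2 : ∀ ξ, cutoff (ξ 0 / ε) * fluxDensity α n x ξ =
      cutWeight α ε x ξ * ⟪ξ - x, n ξ⟫ := by
    intro ξ
    rw [fluxDensity, cutWeight]; ring
  simp_rw [h2]
  rw [← h1]
  set H := indicator ((fun z => x + ε • z) ⁻¹' Ω) (halfSpaceKernel m α) with hH
  -- The Jacobian `ε^m` matches the degree `-m` of the divergence, so no power of `ε` is left after
  -- rescaling.
  have hscale : ∫ ξ, H (ε⁻¹ • (ξ - x)) = ε ^ m * ∫ z, H z := by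
    rw [integral_sub_right_eq_self (fun ξ => H (ε⁻¹ • ξ)) x, Measure.integral_comp_smul,
      finrank_euclideanSpace_fin, inv_pow, inv_inv, abs_of_pos (by positivity), smul_eq_mul]
  have hεm : ε ^ m ≠ 0 := by positivity
  rw [← mul_right_inj' hεm, ← hscale, ← integral_indicator h.isOpen.measurableSet,
    ← integral_const_mul]
  congr 1 with ξ
  have hback : x + ε • ε⁻¹ • (ξ - x) = ξ := by
    rw [smul_inv_smul₀ hε.ne', add_sub_cancel]
  by_cases hξ : ξ ∈ Ω
  · have hξ0 := h.pos_of_mem ξ hξ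
    rw [indicator_of_mem hξ, hH, indicator_of_mem (by rw [mem_preimage, hback]; exact hξ),
      fderiv_cutWeight_apply hε hx hξ0, halfSpaceKernel]
    have hc : (ε⁻¹ • (ξ - x)) 0 = ξ 0 / ε := by
      simp [hx, div_eq_inv_mul]
    rw [hc, norm_smul, norm_inv, Real.norm_of_nonneg hε.le, mul_pow, inv_pow,
      Real.mul_rpow (by positivity) (by positivity), Real.div_rpow hξ0.le hε.le,
      Real.inv_rpow (by positivity), ← Real.rpow_neg (by positivity), neg_neg,
      ← Real.rpow_natCast ε 2, ← Real.rpow_mul hε.le]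
    have : ε ^ (((2 : ℕ) : ℝ) * (α + (m : ℝ) / 2)) = ε ^ m * ε ^ (2 * α) := by
      rw [← Real.rpow_natCast ε m, ← Real.rpow_add hε]; congr 1; push_cast; ring
    rw [this]
    have hεα : ε ^ (2 * α) ≠ 0 := by positivity
    field_simp
  · rw [indicator_of_notMem hξ, hH, indicator_of_notMem (by rw [mem_preimage, hback]; exact hξ),
      mul_zero]

end IsLyapunovDomain

/-- With `b = α + (m-2)/2`, the factor `2α + m - 2 = 2b` is absorbed by `Γ(b + 1) = b Γ(b)`; the
rest is Legendre's duplication formula for `Γ(α) Γ(α + 1/2)`. -/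
lemma kOne_mul_eq_one {m : ℕ} (hm : 2 < m) {α : ℝ} (hα : 0 < α) :
    kOne m α * (2 * α + m - 2) * (Real.pi ^ (((m : ℝ) - 1) / 2) * Real.Gamma (α + 1 / 2) /
      Real.Gamma (α + (m : ℝ) / 2)) = 1 := by
  have hm' : (2 : ℝ) < m := by exact_mod_cast hm
  set b := α + ((m : ℝ) - 2) / 2 with hb
  have hb0 : 0 < b := by rw [hb]; linarith
  have hΓ : Real.Gamma (α + (m : ℝ) / 2) = b * Real.Gamma b := by
    rw [← Real.Gamma_add_one hb0.ne']; congr 1; rw [hb]; ring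
  have hdup := Real.Gamma_mul_Gamma_add_half α
  have h4 : (4 : ℝ) ^ (1 - α) = 2 * 2 ^ (1 - 2 * α) := by
    rw [show (4 : ℝ) = 2 ^ (2 : ℝ) by norm_num, ← Real.rpow_mul zero_le_two,
      show (2 : ℝ) * (1 - α) = 1 + (1 - 2 * α) by ring, Real.rpow_add two_pos, Real.rpow_one]
  have hpi : Real.pi ^ ((m : ℝ) / 2) = Real.pi ^ (((m : ℝ) - 1) / 2) * √Real.pi := by
    rw [Real.sqrt_eq_rpow, ← Real.rpow_add Real.pi_pos]; congr 1; ring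
  have h1 := (Real.Gamma_pos_of_pos hb0).ne'
  have h2 := (Real.Gamma_pos_of_pos (show 0 < 2 * α by linarith)).ne'
  have h3 : (Real.pi ^ (((m : ℝ) - 1) / 2)) ≠ 0 := by positivity
  have h5 : √Real.pi ≠ 0 := by positivity
  have h6 : (2 : ℝ) ^ (1 - 2 * α) ≠ 0 := by positivity
  rw [kOne, ← hb, hΓ, h4, hpi, show 2 * α + (m : ℝ) - 2 = 2 * b by rw [hb]; ring]
  generalize Real.Gamma (α + 1 / 2) = g at hdup ⊢
  field_simp
  linear_combination hdup

lemma ae_inner_ne_zero {E : Type*} [NormedAddCommGroup E] [InnerProductSpace ℝ E]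
    [FiniteDimensional ℝ E] [MeasurableSpace E] [BorelSpace E] {b : E} (hb : b ≠ 0) :
    ∀ᵐ z : E, ⟪b, z⟫ ≠ 0 := by
  have hsub : (ℝ ∙ b)ᗮ ≠ ⊤ := by
    intro htop
    have : b ∈ (ℝ ∙ b)ᗮ := htop ▸ mem_top
    rw [mem_orthogonal_singleton_iff_inner_right, inner_self_eq_zero] at this
    exact hb this
  have := Measure.addHaar_submodule (volume : Measure E) _ hsub
  rw [ae_iff]
  convert this using 2
  ext z
  simp [mem_orthogonal_singleton_iff_inner_right]

/-! ### Symmetry of the limit kernel -/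

section Reflection

variable {m : ℕ} [NeZero m]

/-- The kernel is even in the variables along the hyperplane, so that a half-space with boundary
orthogonal to the hyperplane carries half of its mass. -/
lemma integral_indicator_halfSpaceKernel {α : ℝ} (hα : 0 < α) {b : EuclideanSpace ℝ (Fin m)}
    (hb : b ≠ 0) (hb0 : b 0 = 0) :
    ∫ z, indicator {z | ⟪b, z⟫ < 0} (halfSpaceKernel m α) z =
      1 / 2 * ∫ z, halfSpaceKernel m α z := by
  set e : EuclideanSpace ℝ (Fin m) := EuclideanSpace.single 0 1 with he
  have hen : ‖e‖ = 1 := by simp [he]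
  have hz : ∀ z : EuclideanSpace ℝ (Fin m), ⟪e, z⟫ = z 0 := fun z => by
    simp [he, EuclideanSpace.inner_single_left]
  -- The reflection in the line spanned by `e` keeps `z₁` and `‖z‖`, hence the kernel, and changes
  -- the sign of `⟪b, z⟫` because `b ⊥ e`.
  set R := (ℝ ∙ e).reflection with hR
  have hRz : ∀ z, R z = (2 * z 0) • e - z := fun z => by
    rw [hR, reflection_singleton_apply, hz, hen]
    simp [two_smul, add_smul, two_mul]
  have hR0 : ∀ z, R z 0 = z 0 := fun z => by
    rw [← hz, hRz, inner_sub_right, inner_smul_right, real_inner_self_eq_norm_sq, hen, hz]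
    ring
  have hRb : ∀ z, ⟪b, R z⟫ = -⟪b, z⟫ := fun z => by
    rw [hRz, inner_sub_right, inner_smul_right, real_inner_comm, hz, hb0]
    ring
  have hRK : ∀ z, halfSpaceKernel m α (R z) = halfSpaceKernel m α z := fun z => by
    rw [halfSpaceKernel, halfSpaceKernel, hR0, LinearIsometryEquiv.norm_map]
  have hint := (integrable_and_integral_halfSpaceKernel (m := m) hα).1
  have hcont : Continuous fun z : EuclideanSpace ℝ (Fin m) => ⟪b, z⟫ := by fun_prop
  have hm₁ : MeasurableSet {z : EuclideanSpace ℝ (Fin m) | ⟪b, z⟫ < 0} :=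
    (isOpen_lt hcont continuous_const).measurableSet
  have hm₂ : MeasurableSet {z : EuclideanSpace ℝ (Fin m) | 0 < ⟪b, z⟫} :=
    (isOpen_lt continuous_const hcont).measurableSet
  have hsymm : ∫ z, indicator {z | ⟪b, z⟫ < 0} (halfSpaceKernel m α) z =
      ∫ z, indicator {z | 0 < ⟪b, z⟫} (halfSpaceKernel m α) z := by
    rw [← R.measurePreserving.integral_comp R.toHomeomorph.measurableEmbedding]
    congr 1 with z
    by_cases h : 0 < ⟪b, z⟫
    · rw [indicator_of_mem (show R z ∈ {z | ⟪b, z⟫ < 0} by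
        change ⟪b, R z⟫ < 0; rw [hRb]; linarith), indicator_of_mem (by exact h), hRK]
    · rw [indicator_of_notMem (show R z ∉ {z | ⟪b, z⟫ < 0} by
        change ¬ ⟪b, R z⟫ < 0; rw [hRb]; linarith), indicator_of_notMem (by exact h)]
  have hnull : ∀ᵐ z : EuclideanSpace ℝ (Fin m), ⟪b, z⟫ ≠ 0 := ae_inner_ne_zero hb
  have hsum : ∫ z, halfSpaceKernel m α z =
      (∫ z, indicator {z | ⟪b, z⟫ < 0} (halfSpaceKernel m α) z) +
        ∫ z, indicator {z | 0 < ⟪b, z⟫} (halfSpaceKernel m α) z := by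
    rw [← integral_add (hint.indicator hm₁) (hint.indicator hm₂)]
    refine integral_congr_ae ?_
    filter_upwards [hnull] with z hz
    rcases lt_or_gt_of_ne hz with h | h
    · rw [indicator_of_mem (by exact h), indicator_of_notMem (by exact not_lt.2 h.le), add_zero]
    · rw [indicator_of_notMem (by exact not_lt.2 h.le), indicator_of_mem (by exact h), zero_add]
  rw [hsum, ← hsymm]
  ring

end Reflection

/-! ### Removing the cutoff: tangent cones and the three values -/

namespace IsLyapunovDomain

variable {m : ℕ} [NeZero m] {Ω Γ₁ Γ : Set (EuclideanSpace ℝ (Fin m))}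
  {n : EuclideanSpace ℝ (Fin m) → EuclideanSpace ℝ (Fin m)}

/-- Dominated convergence, with absolute convergence of the flux providing the majorant; at each
point of `Γ` the cutoff equals `1` once `ε ≤ ξ₁ / 2`. -/
lemma tendsto_setIntegral_cutoff_mul_fluxDensity (h : IsLyapunovDomain Ω Γ₁ Γ n) {α : ℝ}
    (hα : 0 < α) (hm : 2 < m) {x : EuclideanSpace ℝ (Fin m)} (hx : x 0 = 0) :
    Tendsto (fun ε : ℝ => ∫ ξ in Γ, cutoff (ξ 0 / ε) * fluxDensity α n x ξ ∂μHE[m - 1]) (𝓝[>] 0)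
      (𝓝 (∫ ξ in Γ, fluxDensity α n x ξ ∂μHE[m - 1])) := by
  have hint := h.integrableOn_fluxDensity hα hm hx
  refine tendsto_integral_filter_of_dominated_convergence (fun ξ => ‖fluxDensity α n x ξ‖) ?_ ?_
    hint.norm ?_
  · refine Eventually.of_forall fun ε => AEStronglyMeasurable.mul ?_ hint.aestronglyMeasurable
    have := (contDiff_cutoff (k := 0)).continuous
    exact (by fun_prop : Continuous fun ξ : EuclideanSpace ℝ (Fin m) =>
      cutoff (ξ 0 / ε)).aestronglyMeasurable
  · refine Eventually.of_forall fun ε => ae_of_all _ fun ξ => ?_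
    rw [norm_mul, Real.norm_of_nonneg (cutoff_nonneg _)]
    exact mul_le_of_le_one_left (norm_nonneg _) (cutoff_le_one _)
  · refine (ae_restrict_iff' h.measurableSet_surface).2 (ae_of_all _ fun ξ hξ => ?_)
    have hξ0 := h.pos_of_mem_surface ξ hξ
    refine tendsto_const_nhds.congr' ?_
    filter_upwards [Ioo_mem_nhdsGT (show 0 < ξ 0 / 2 by positivity)] with ε hε
    rw [cutoff_of_two_le, one_mul]
    rw [le_div_iff₀ hε.1]
    linarith [hε.2]

/-- The flux through the surface, from the tangent cone of the domain. -/
lemma setIntegral_fluxDensity_eq (h : IsLyapunovDomain Ω Γ₁ Γ n) {α : ℝ} (hα : 0 < α) (hm : 2 < m)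
    {x : EuclideanSpace ℝ (Fin m)} (hx : x 0 = 0) {S : Set (EuclideanSpace ℝ (Fin m))}
    (hS : ∀ᵐ z, 0 < z 0 → ∀ᶠ ε : ℝ in 𝓝[>] 0, x + ε • z ∈ Ω ↔ z ∈ S) :
    ∫ ξ in Γ, fluxDensity α n x ξ ∂μHE[m - 1] = ∫ z, indicator S (halfSpaceKernel m α) z := by
  have hint := (integrable_and_integral_halfSpaceKernel (m := m) hα).1
  refine tendsto_nhds_unique (h.tendsto_setIntegral_cutoff_mul_fluxDensity hα hm hx) ?_
  have hcongr : (fun ε : ℝ => ∫ z, indicator ((fun z => x + ε • z) ⁻¹' Ω) (halfSpaceKernel m α) z)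
      =ᶠ[𝓝[>] 0] fun ε => ∫ ξ in Γ, cutoff (ξ 0 / ε) * fluxDensity α n x ξ ∂μHE[m - 1] := by
    filter_upwards [self_mem_nhdsWithin] with ε hε
    exact (h.setIntegral_cutoff_mul_fluxDensity hε hx).symm
  refine Tendsto.congr' hcongr ?_
  refine tendsto_integral_filter_of_dominated_convergence (fun z => ‖halfSpaceKernel m α z‖) ?_ ?_
    hint.norm ?_
  · refine Eventually.of_forall fun ε => hint.aestronglyMeasurable.indicator ?_
    exact (h.isOpen.preimage (by fun_prop)).measurableSet
  · exact Eventually.of_forall fun ε => ae_of_all _ fun z => norm_indicator_le_norm_self _ _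
  · filter_upwards [hS] with z hz
    -- The kernel vanishes for `z₁ ≤ 0`, so the tangent cone matters only in the open half-space.
    by_cases hz0 : 0 < z 0
    · refine tendsto_const_nhds.congr' ?_
      filter_upwards [hz hz0] with ε hε
      by_cases hzS : z ∈ S
      · rw [indicator_of_mem hzS, indicator_of_mem (by exact hε.2 hzS)]
      · rw [indicator_of_notMem hzS, indicator_of_notMem (by exact fun h' => hzS (hε.1 h'))]
    · have h0 : ∀ T : Set (EuclideanSpace ℝ (Fin m)),
          indicator T (halfSpaceKernel m α) z = 0 := fun T => by
        exact indicator_apply_eq_zero.2 fun _ => halfSpaceKernel_of_nonpos (not_lt.1 hz0)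
      simp_rw [h0]
      exact tendsto_const_nhds

lemma tendsto_add_smul {E : Type*} [NormedAddCommGroup E] [NormedSpace ℝ E] (x z : E) :
    Tendsto (fun ε : ℝ => x + ε • z) (𝓝[>] 0) (𝓝 x) := by
  have : Continuous fun ε : ℝ => x + ε • z := by fun_prop
  simpa using (this.tendsto 0).mono_left nhdsWithin_le_nhds

/-- Near a point of the flat part, the domain is a half-ball. -/
lemma exists_ball_inter_subset (h : IsLyapunovDomain Ω Γ₁ Γ n) {x : EuclideanSpace ℝ (Fin m)}
    (hx : x ∈ Γ₁) : ∃ r > 0, Metric.ball x r ∩ {ξ | 0 < ξ 0} ⊆ Ω := by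
  have hxΓ : x ∉ closure Γ := by
    rw [h.closure_surface]
    rintro (hΓ | he)
    · exact (h.pos_of_mem_surface x hΓ).ne' (h.zero_of_mem_flat x hx)
    · exact he.2 hx
  obtain ⟨r, hr, hball⟩ := Metric.mem_nhds_iff.1
    (isClosed_closure.isOpen_compl.mem_nhds (show x ∈ (closure Γ)ᶜ from hxΓ))
  refine ⟨r, hr, ?_⟩
  have hconv : Convex ℝ (Metric.ball x r ∩ {ξ : EuclideanSpace ℝ (Fin m) | 0 < ξ 0}) := by
    refine (convex_ball x r).inter ?_
    exact convex_halfSpace_gt (f := fun ξ : EuclideanSpace ℝ (Fin m) => ξ 0)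
      ⟨fun _ _ => rfl, fun _ _ => rfl⟩ 0
  have hxcl : x ∈ closure Ω := frontier_subset_closure (by
    rw [h.frontier_eq]; exact Or.inl (Or.inl hx))
  obtain ⟨y, hyb, hyΩ⟩ := mem_closure_iff.1 hxcl _ Metric.isOpen_ball (Metric.mem_ball_self hr)
  -- The half-ball is connected, meets `Ω`, and contains no boundary point of `Ω` because the ball
  -- avoids `Γ`; hence it lies in `Ω`.
  refine hconv.isPreconnected.subset_of_closure_inter_subset h.isOpen
    ⟨y, ⟨hyb, h.pos_of_mem y hyΩ⟩, hyΩ⟩ ?_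
  rintro ξ ⟨hξ, hξb, hξ0⟩
  exact (h.mem_or_mem_of_pos hξ hξ0).resolve_right fun hΓ => hball hξb (subset_closure hΓ)

lemma setIntegral_fluxDensity_of_mem_flat (h : IsLyapunovDomain Ω Γ₁ Γ n) {α : ℝ} (hα : 0 < α)
    (hm : 2 < m) {x : EuclideanSpace ℝ (Fin m)} (hx : x ∈ Γ₁) :
    ∫ ξ in Γ, fluxDensity α n x ξ ∂μHE[m - 1] = ∫ z, halfSpaceKernel m α z := by
  have hx0 := h.zero_of_mem_flat x hx
  obtain ⟨r, hr, hsub⟩ := h.exists_ball_inter_subset hx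
  rw [h.setIntegral_fluxDensity_eq hα hm hx0 (S := univ), indicator_univ]
  refine ae_of_all _ fun z hz => ?_
  filter_upwards [tendsto_add_smul x z (Metric.ball_mem_nhds x hr), self_mem_nhdsWithin]
    with ε hε hε0
  refine iff_of_true (hsub ⟨hε, ?_⟩) (mem_univ z)
  have : 0 < ε * z 0 := mul_pos hε0 hz
  simpa [hx0] using this

lemma setIntegral_fluxDensity_of_notMem (h : IsLyapunovDomain Ω Γ₁ Γ n) {α : ℝ} (hα : 0 < α)
    (hm : 2 < m) {x : EuclideanSpace ℝ (Fin m)} (hx0 : x 0 = 0) (hx : x ∉ Γ₁ ∪ edge Γ₁) :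
    ∫ ξ in Γ, fluxDensity α n x ξ ∂μHE[m - 1] = 0 := by
  have hxcl : x ∉ closure Ω := by
    intro hcl
    have hf : x ∈ frontier Ω := by
      rw [h.isOpen.frontier_eq]
      exact ⟨hcl, fun hΩ => (h.pos_of_mem x hΩ).ne' hx0⟩
    rw [h.frontier_eq] at hf
    exact hf.elim hx fun hΓ => (h.pos_of_mem_surface x hΓ).ne' hx0
  rw [h.setIntegral_fluxDensity_eq hα hm hx0 (S := ∅)]
  · simp
  refine ae_of_all _ fun z _ => ?_
  filter_upwards [tendsto_add_smul x z (isClosed_closure.isOpen_compl.mem_nhds hxcl)] with ε hε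
  exact iff_of_false (fun hΩ => hε (subset_closure hΩ)) (notMem_empty z)

/-- The derivative of `φ` at `x` along `z` is a positive multiple of `⟪n x, z⟫`, so its sign decides
whether `x + εz` lies in `Ω` for small `ε`. Directions tangent to the surface form a null set. -/
lemma setIntegral_fluxDensity_of_mem_edge (h : IsLyapunovDomain Ω Γ₁ Γ n) {α : ℝ} (hα : 0 < α)
    (hm : 2 < m) {x : EuclideanSpace ℝ (Fin m)} (hx : x ∈ edge Γ₁) :
    ∫ ξ in Γ, fluxDensity α n x ξ ∂μHE[m - 1] = 1 / 2 * ∫ z, halfSpaceKernel m α z := by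
  have hx0 := h.zero_of_mem_edge x hx
  obtain ⟨hn, r, φ, a, hr, ha, hgrad, hφ, -, -, hΓ, hΩ, -⟩ :=
    h.exists_flat_ball (Or.inr hx) one_pos
  have hball := Metric.ball_mem_nhds x hr
  have hφx : φ x = 0 := ((hΓ x (Metric.mem_ball_self hr)).1 (Or.inr hx)).2
  have hn0 : n x ≠ 0 := norm_ne_zero_iff.1 (by rw [hn]; exact one_ne_zero)
  rw [h.setIntegral_fluxDensity_eq hα hm hx0 (S := {z | ⟪n x, z⟫ < 0}),
    integral_indicator_halfSpaceKernel hα hn0 (h.right_angle x hx)]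
  have hnull : ∀ᵐ z : EuclideanSpace ℝ (Fin m), ⟪n x, z⟫ ≠ 0 := ae_inner_ne_zero hn0
  filter_upwards [hnull] with z hz hz0
  have hd : DifferentiableAt ℝ φ x := (hφ.contDiffAt hball).differentiableAt one_ne_zero
  have hline : HasDerivAt (fun t : ℝ => φ (x + t • z)) (a * ⟪n x, z⟫) 0 := by
    have h1 : HasDerivAt (fun t : ℝ => x + t • z) z 0 := by
      simpa using ((hasDerivAt_id (0 : ℝ)).smul_const z).const_add x
    have h2 : HasFDerivAt φ (fderiv ℝ φ x) (x + (0 : ℝ) • z) := by simpa using hd.hasFDerivAt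
    have h3 := h2.comp_hasDerivAt (0 : ℝ) h1
    rwa [← inner_gradient_left, hgrad, real_inner_smul_left] at h3
  have hslope := (hasDerivAt_iff_tendsto_slope_zero.1 hline).mono_left
    (nhdsWithin_mono 0 fun t (ht : 0 < t) => ht.ne')
  simp only [zero_add, zero_smul, add_zero, hφx, sub_zero, smul_eq_mul] at hslope
  have hmem := tendsto_add_smul x z hball
  rcases lt_or_gt_of_ne hz with hlt | hgt
  · filter_upwards [hslope.eventually_lt_const (mul_neg_of_pos_of_neg ha hlt), hmem,
      self_mem_nhdsWithin] with ε h1 h2 h3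
    have h3 : 0 < ε := h3
    refine iff_of_true ((hΩ _ h2).2 ⟨?_, ?_⟩) hlt
    · have : 0 < ε * z 0 := mul_pos h3 hz0
      simpa [hx0] using this
    · exact (pos_iff_neg_of_mul_neg h1).1 (inv_pos.2 h3)
  · filter_upwards [hslope.eventually_const_lt (mul_pos ha hgt), hmem,
      self_mem_nhdsWithin] with ε h1 h2 h3
    have h3 : 0 < ε := h3
    refine iff_of_false (fun h' => ?_) (not_lt.2 hgt.le)
    have := ((hΩ _ h2).1 h').2
    exact this.not_gt ((pos_iff_pos_of_mul_pos h1).1 (inv_pos.2 h3))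

end IsLyapunovDomain

theorem lemma2 {m : ℕ} [NeZero m] (hm : 2 < m) (α : ℝ) (hα₀ : 0 < 2 * α) (hα₁ : 2 * α < 1)
    (Ω Γ₁ Γ : Set (EuclideanSpace ℝ (Fin m)))
    (n : EuclideanSpace ℝ (Fin m) → EuclideanSpace ℝ (Fin m))
    (hΩ : IsLyapunovDomain Ω Γ₁ Γ n)
    (x : EuclideanSpace ℝ (Fin m)) (hx : x 0 = 0) :
    IntegrableOn (doubleLayerIntegrand α n (fun _ => 1) x) Γ (μHE[m - 1]) ∧
      (x ∈ Γ₁ → doubleLayer α Γ n (fun _ => 1) x = -1) ∧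
      (x ∈ edge Γ₁ → doubleLayer α Γ n (fun _ => 1) x = -(1 / 2)) ∧
      (x ∉ Γ₁ ∪ edge Γ₁ → doubleLayer α Γ n (fun _ => 1) x = 0) := by
  have hα : 0 < α := by linarith
  have hcongr : EqOn (doubleLayerIntegrand α n (fun _ => 1) x)
      (fun ξ => -(kOne m α * (2 * α + m - 2)) * fluxDensity α n x ξ) Γ := fun ξ hξ =>
    doubleLayerIntegrand_eq hα hm n hx (hΩ.ne_of_mem_surface hx hξ)
  have hval : doubleLayer α Γ n (fun _ => 1) x =
      -(kOne m α * (2 * α + m - 2)) * ∫ ξ in Γ, fluxDensity α n x ξ ∂μHE[m - 1] := by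
    rw [doubleLayer, setIntegral_congr_fun hΩ.measurableSet_surface hcongr, integral_const_mul]
  have hconst := kOne_mul_eq_one hm hα
  rw [← (integrable_and_integral_halfSpaceKernel (m := m) hα).2] at hconst
  refine ⟨?_, fun h => ?_, fun h => ?_, fun h => ?_⟩
  · exact (integrableOn_congr_fun hcongr hΩ.measurableSet_surface).2
      ((hΩ.integrableOn_fluxDensity hα hm hx).const_mul _)
  · rw [hval, hΩ.setIntegral_fluxDensity_of_mem_flat hα hm h]
    linarith
  · rw [hval, hΩ.setIntegral_fluxDensity_of_mem_edge hα hm h]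
    linarith
  · rw [hval, hΩ.setIntegral_fluxDensity_of_notMem hα hm hx h, mul_zero]
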